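/- **Conventions.** Discrete groups are countable. Measurability and relations between measurable sets and maps are understood up to null sets. Let $(X,\mu)$ be a standard Borel space with a Borel probability measure. A *discrete measured groupoid* $\mathcal G$ on $(X,\mu)$ is a groupoid with unit space $X$, endowed with a standard Borel structure for which the range map $r$, the source map $s$, the inverse and the product are Borel, such that every fiber $\mathcal G^y=r^{-1}(y)$ is countable and $\mu$ is quasi-invariant, i.e. the measure $\tilde\mu(E)=\int_X|E\cap\mathcal G_x|\,d\mu(x)$ on $\mathcal G$, where $\mathcal G_x=s^{-1}(x)$, is equivalent to its image under the inverse map. "A.e. $g\in\mathcal G$" refers to $\tilde\mu$, and "a.e. composable pair $(g,h)$" to the measure $E\mapsto\int_X|\{(g,h)\in E : s(h)=x\}|\,d\mu(x)$. Write $e_x$ for the unit at $x$ and $\mathcal G|_Y=\{g: r(g),s(g)\in Y\}$. A *subgroupoid* is a measurable subgroupoid with unit space $X$. A *homomorphism* $\alpha:\mathcal G\to\mathcal H$ of discrete measured groupoids is a measurable map which pushes the measure of $\mathcal G$ to a measure absolutely continuous with respect to that of $\mathcal H$ and satisfies, for a.e. composable pair $(g,h)$, that $\alpha(g),\alpha(h)$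 are composable and $\alpha(gh)=\alpha(g)\alpha(h)$; a discrete group is viewed as a groupoid on one point. A *central subgroupoid* of $\mathcal G$ is a pair $(C,\iota)$ of a discrete group $C$ and an injective homomorphism $\iota:C\ltimes X\to\mathcal G$ (where $C$ acts trivially on $X$) inducing the identity on $X$ and such that for every $c\in C$ and a.e. $g\in\mathcal G$, $g\,\iota(c,s(g))=\iota(c,r(g))\,g$. Write $gc=g\,\iota(c,s(g))$ and let $\mathcal G/C$ be the quotient groupoid. A measurable function $\phi:\mathcal G\to\mathbb C$ is *positive definite* if for a.e. $x\in X$, all $g_1,\dots,g_n\in\mathcal G^x$ and all $\lambda_1,\dots,\lambda_n\in\mathbb C$, $\sum_{i,j}\overline{\lambda_i}\lambda_j\phi(g_i^{-1}g_j)\ge 0$; it is *normalized* if $\phi(e_x)=1$ for a.e. $x$. A measurable function $\phi$ on a discrete measured groupoid $\mathcal G$ is $c_0$ if for all $\delta,\varepsilon>0$ there is a measurable $Y\subset X$ with $\mu(X\setminus Y)<\delta$ such that for a.e. $x\in Y$ the set $\{g\in(\mathcal G|_Y)_x : |\phi(g)|>\varepsilon\}$ is finite. The pair $(\mathcal G,(C,\iota))$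 has the *generalized Haagerup property (gHAP)* if there are a sequence $(V_n)_n$ of compact neighborhoods of the trivial character in the character group $\widehat C$ and normalized positive definite functions $\phi^n_\chi$ on $\mathcal G$ ($n\in\mathbb N$, $\chi\in V_n$) such that 1. for a.e. $g\in\mathcal G$ and every $\varepsilon>0$ there is $N$ with $|\phi^n_\chi(g)-1|<\varepsilon$ for all $n\ge N$ and $\chi\in V_n$; 2. for every $n$ and $\chi\in V_n$, for a.e. $g\in\mathcal G$ and every $c\in C$, $\phi^n_\chi(gc)=\phi^n_\chi(g)\chi(c)$; 3. for every $n$ and a.e. $g\in\mathcal G$, the function $\chi\mapsto\phi^n_\chi(g)$ is continuous on $V_n$; 4. for every $n$ and $\chi\in V_n$, the function on $\mathcal G/C$ induced by $|\phi^n_\chi|$ is $c_0$. **Proposition 4.15.** Let $\mathcal G$ be a discrete measured groupoid on $(X,\mu)$ and $\mathcal S$ a subgroupoid of $\mathcal G$. Let $(C,\iota)$ be a central subgroupoid of $\mathcal G$ such that the image of $\iota$ is contained in $\mathcal S$. Suppose that there exist an amenable discrete group $A$ (i.e. a countable group admitting a Følner sequence) and a homomorphism $\alpha:\mathcal G\to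 A$ such that $\ker\alpha=\mathcal S$ and either $A$ is abelian or $\alpha$ is class-surjective, i.e. $\alpha(\mathcal G_x)=A$ for a.e. $x\in X$. If the pair $(\mathcal S,(C,\iota))$ has the gHAP, then so does the pair $(\mathcal G,(C,\iota))$. -/

import Mathlib

open MeasureTheory Filter Topology
open scoped Pointwise ComplexOrder

noncomputable section

/-- For a map `p : Y → X`, the measure `E ↦ ∫ |E ∩ p ⁻¹ {x}| dμ(x)` on `Y`.
When `Y` and `X` are standard Borel and `p` is Borel and countable-to-one, the fibrewise counting
measures form a measurable family, so that this is the stated integral for every Borel set `E`. -/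
def fiberCount {X Y : Type*} [MeasurableSpace X] [MeasurableSpace Y] (p : Y → X) (μ : Measure X) :
    Measure Y :=
  μ.bind fun x => Measure.count.restrict (p ⁻¹' {x})

/-- A discrete Borel groupoid with unit space `X` and set of arrows `G`. The product `mul g h` is
meaningful only if `s g = r h`; its values on other pairs play no role. -/
structure DiscreteBorelGroupoid (X G : Type*) [MeasurableSpace X] [MeasurableSpace G] where
  /-- the range map -/
  r : G → X
  /-- the source map -/
  s : G → X
  /-- the unit `e_x` at `x` -/
  unit : X → G
  inv : G → G
  mul : G → G → G
  r_unit : ∀ x, r (unit x) = x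
  s_unit : ∀ x, s (unit x) = x
  r_inv : ∀ g, r (inv g) = s g
  s_inv : ∀ g, s (inv g) = r g
  r_mul : ∀ g h, s g = r h → r (mul g h) = r g
  s_mul : ∀ g h, s g = r h → s (mul g h) = s h
  mul_assoc : ∀ g h k, s g = r h → s h = r k → mul (mul g h) k = mul g (mul h k)
  unit_mul : ∀ g, mul (unit (r g)) g = g
  mul_unit : ∀ g, mul g (unit (s g)) = g
  inv_mul : ∀ g, mul (inv g) g = unit (s g)
  mul_inv : ∀ g, mul g (inv g) = unit (r g)
  measurable_r : Measurable r
  measurable_s : Measurable s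
  measurable_inv : Measurable inv
  measurable_mul : Measurable fun p : {p : G × G // s p.1 = r p.2} => mul p.1.1 p.1.2
  countable_fiber : ∀ y, (r ⁻¹' {y}).Countable

namespace DiscreteBorelGroupoid

section

variable {X G : Type*} [MeasurableSpace X] [MeasurableSpace G]

/-- The measure `E ↦ ∫ |E ∩ 𝒢_x| dμ(x)` on the arrows, where `𝒢_x = s ⁻¹ {x}`. -/
def arrowMeasure (𝒢 : DiscreteBorelGroupoid X G) (μ : Measure X) : Measure G :=
  fiberCount 𝒢.s μ

/-- The set of composable pairs. -/
abbrev Composable (𝒢 : DiscreteBorelGroupoid X G) : Type _ :=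
  {p : G × G // 𝒢.s p.1 = 𝒢.r p.2}

/-- The measure on composable pairs obtained by counting over `(g, h) ↦ s h`. -/
def pairMeasure (𝒢 : DiscreteBorelGroupoid X G) (μ : Measure X) : Measure 𝒢.Composable :=
  fiberCount (fun p : 𝒢.Composable => 𝒢.s p.1.2) μ

/-- `μ` is quasi-invariant: the measure on arrows is equivalent to its image under inversion. -/
def IsQuasiInvariant (𝒢 : DiscreteBorelGroupoid X G) (μ : Measure X) : Prop :=
  𝒢.arrowMeasure μ ≪ (𝒢.arrowMeasure μ).map 𝒢.inv ∧
    (𝒢.arrowMeasure μ).map 𝒢.inv ≪ 𝒢.arrowMeasure μ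

/-- A homomorphism of discrete measured groupoids. -/
structure IsHom {Y H : Type*} [MeasurableSpace Y] [MeasurableSpace H]
    (𝒢 : DiscreteBorelGroupoid X G) (μ : Measure X)
    (ℋ : DiscreteBorelGroupoid Y H) (ν : Measure Y) (α : G → H) : Prop where
  aemeasurable : AEMeasurable α (𝒢.arrowMeasure μ)
  absolutelyContinuous : (𝒢.arrowMeasure μ).map α ≪ ℋ.arrowMeasure ν
  map_mul : ∀ᵐ p ∂(𝒢.pairMeasure μ), ℋ.s (α p.1.1) = ℋ.r (α p.1.2) ∧
    α (𝒢.mul p.1.1 p.1.2) = ℋ.mul (α p.1.1) (α p.1.2)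

/-- A set of arrows that contains all units and is closed under products and inverses. -/
structure Subgroupoid (𝒢 : DiscreteBorelGroupoid X G) where
  carrier : Set G
  unit_mem : ∀ x, 𝒢.unit x ∈ carrier
  inv_mem : ∀ g ∈ carrier, 𝒢.inv g ∈ carrier
  mul_mem : ∀ g ∈ carrier, ∀ h ∈ carrier, 𝒢.s g = 𝒢.r h → 𝒢.mul g h ∈ carrier

/-- The product of a subgroupoid; an irrelevant value for pairs that are not composable. -/
def Subgroupoid.mul {𝒢 : DiscreteBorelGroupoid X G} (𝒮 : 𝒢.Subgroupoid) (g h : 𝒮.carrier) :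
    𝒮.carrier := by
  classical exact if hc : 𝒢.s g = 𝒢.r h then ⟨𝒢.mul g h, 𝒮.mul_mem g g.2 h h.2 hc⟩ else g

theorem Subgroupoid.coe_mul {𝒢 : DiscreteBorelGroupoid X G} (𝒮 : 𝒢.Subgroupoid)
    (g h : 𝒮.carrier) (hc : 𝒢.s g = 𝒢.r h) : (𝒮.mul g h : G) = 𝒢.mul g h := by
  unfold Subgroupoid.mul
  rw [dif_pos hc]

/-- A subgroupoid as a groupoid in its own right. -/
def Subgroupoid.toGroupoid {𝒢 : DiscreteBorelGroupoid X G} (𝒮 : 𝒢.Subgroupoid) :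
    DiscreteBorelGroupoid X 𝒮.carrier where
  r g := 𝒢.r g
  s g := 𝒢.s g
  unit x := ⟨𝒢.unit x, 𝒮.unit_mem x⟩
  inv g := ⟨𝒢.inv g, 𝒮.inv_mem g g.2⟩
  mul := 𝒮.mul
  r_unit := 𝒢.r_unit
  s_unit := 𝒢.s_unit
  r_inv g := 𝒢.r_inv g
  s_inv g := 𝒢.s_inv g
  r_mul g h hc := by
    rw [𝒮.coe_mul g h hc]
    exact 𝒢.r_mul g h hc
  s_mul g h hc := by
    rw [𝒮.coe_mul g h hc]
    exact 𝒢.s_mul g h hc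
  mul_assoc g h k h1 h2 := by
    have h3 : 𝒢.s (𝒮.mul g h) = 𝒢.r k := by
      rw [𝒮.coe_mul g h h1]
      exact (𝒢.s_mul g h h1).trans h2
    have h4 : 𝒢.s g = 𝒢.r (𝒮.mul h k) := by
      rw [𝒮.coe_mul h k h2]
      exact h1.trans (𝒢.r_mul h k h2).symm
    apply Subtype.ext
    rw [𝒮.coe_mul _ _ h3, 𝒮.coe_mul _ _ h4, 𝒮.coe_mul _ _ h1, 𝒮.coe_mul _ _ h2]
    exact 𝒢.mul_assoc g h k h1 h2
  unit_mul g := Subtype.ext <| (𝒮.coe_mul _ _ (𝒢.s_unit _)).trans (𝒢.unit_mul g)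
  mul_unit g := Subtype.ext <| (𝒮.coe_mul _ _ (𝒢.r_unit _).symm).trans (𝒢.mul_unit g)
  inv_mul g := Subtype.ext <| (𝒮.coe_mul _ _ (𝒢.s_inv _)).trans (𝒢.inv_mul g)
  mul_inv g := Subtype.ext <| (𝒮.coe_mul _ _ (𝒢.r_inv _).symm).trans (𝒢.mul_inv g)
  measurable_r := 𝒢.measurable_r.comp measurable_subtype_coe
  measurable_s := 𝒢.measurable_s.comp measurable_subtype_coe
  measurable_inv := (𝒢.measurable_inv.comp measurable_subtype_coe).subtype_mk
  measurable_mul := by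
    have key : Measurable fun p : {p : 𝒮.carrier × 𝒮.carrier // 𝒢.s p.1 = 𝒢.r p.2} =>
        𝒢.mul p.1.1 p.1.2 :=
      𝒢.measurable_mul.comp
        (f := fun p : {p : 𝒮.carrier × 𝒮.carrier // 𝒢.s p.1 = 𝒢.r p.2} =>
          (⟨((p.1.1 : G), (p.1.2 : G)), p.2⟩ : {p : G × G // 𝒢.s p.1 = 𝒢.r p.2}))
        (Measurable.subtype_mk (by fun_prop))
    have h2 := key.subtype_mk (p := fun g => g ∈ 𝒮.carrier)
      (h := fun p => 𝒮.mul_mem p.1.1 p.1.1.2 p.1.2 p.1.2.2 p.2)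
    convert h2 using 2 with p
    exact Subtype.ext (𝒮.coe_mul _ _ p.2)
  countable_fiber y := (𝒢.countable_fiber y).preimage Subtype.val_injective

/-- A map into `𝒢` with values in `𝒮` almost everywhere, regarded as a map into `𝒮`: at the
exceptional points, which form a null set in all uses, it is given the value of a unit. -/
def Subgroupoid.codRestrict {𝒢 : DiscreteBorelGroupoid X G} (𝒮 : 𝒢.Subgroupoid) {C : Type*}
    (ι : C × X → G) (p : C × X) : 𝒮.carrier := by
  classical exact if h : ι p ∈ 𝒮.carrier then ⟨ι p, h⟩ else ⟨𝒢.unit p.2, 𝒮.unit_mem p.2⟩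

end

/-- A discrete countable group as a groupoid on one point. -/
def ofGroup (A : Type*) [Group A] [Countable A] [MeasurableSpace A] [DiscreteMeasurableSpace A] :
    DiscreteBorelGroupoid Unit A where
  r _ := ()
  s _ := ()
  unit _ := 1
  inv a := a⁻¹
  mul a b := a * b
  r_unit _ := rfl
  s_unit _ := rfl
  r_inv _ := rfl
  s_inv _ := rfl
  r_mul _ _ _ := rfl
  s_mul _ _ _ := rfl
  mul_assoc a b c _ _ := _root_.mul_assoc a b c
  unit_mul a := one_mul a
  mul_unit a := mul_one a
  inv_mul a := inv_mul_cancel a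
  mul_inv a := mul_inv_cancel a
  measurable_r := measurable_const
  measurable_s := measurable_const
  measurable_inv := Measurable.of_discrete
  measurable_mul := by
    have h : Measurable fun p : A × A => p.1 * p.2 := Measurable.of_discrete
    exact h.comp measurable_subtype_coe
  countable_fiber _ := Set.to_countable _

/-- The groupoid `C ⋉ X` of the trivial action of a discrete countable group `C` on `X`. -/
def trivialAction (C X : Type*) [Group C] [Countable C] [MeasurableSpace C]
    [DiscreteMeasurableSpace C] [MeasurableSpace X] : DiscreteBorelGroupoid X (C × X) where
  r p := p.2
  s p := p.2
  unit x := (1, x)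
  inv p := (p.1⁻¹, p.2)
  mul p q := (p.1 * q.1, q.2)
  r_unit _ := rfl
  s_unit _ := rfl
  r_inv _ := rfl
  s_inv _ := rfl
  r_mul _ _ h := h.symm
  s_mul _ _ _ := rfl
  mul_assoc p q k _ _ := by simp [_root_.mul_assoc]
  unit_mul p := by simp
  mul_unit p := by simp
  inv_mul p := by simp
  mul_inv p := by simp
  measurable_r := measurable_snd
  measurable_s := measurable_snd
  measurable_inv :=
    ((Measurable.of_discrete (f := fun c : C => c⁻¹)).comp measurable_fst).prodMk measurable_snd
  measurable_mul := by
    have h : Measurable fun p : C × C => p.1 * p.2 := Measurable.of_discrete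
    have h1 : Measurable fun p : {p : (C × X) × (C × X) // p.1.2 = p.2.2} =>
        (p.1.1.1, p.1.2.1) := by fun_prop
    exact (h.comp h1).prodMk (by fun_prop)
  countable_fiber y :=
    (Set.countable_range fun c : C => (c, y)).mono fun p hp => by
      exact ⟨p.1, Prod.ext rfl (by simpa using (Set.mem_preimage.1 hp).symm)⟩

section

variable {X G C : Type*} [MeasurableSpace X] [MeasurableSpace G]

/-- `(C, ι)` is a central subgroupoid of `𝒢`: `ι` is an injective homomorphism from `C ⋉ X` (trivial
action) into `𝒢` that induces the identity on `X` and has central image; all up to null sets. -/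
structure IsCentralSubgroupoid [Group C] [Countable C] [MeasurableSpace C]
    [DiscreteMeasurableSpace C] (𝒢 : DiscreteBorelGroupoid X G) (μ : Measure X)
    (ι : C × X → G) : Prop where
  isHom : (trivialAction C X).IsHom μ 𝒢 μ ι
  injective : ∃ N : Set (C × X), (trivialAction C X).arrowMeasure μ N = 0 ∧ Set.InjOn ι Nᶜ
  unit_space : ∀ᵐ p ∂((trivialAction C X).arrowMeasure μ), 𝒢.r (ι p) = p.2 ∧ 𝒢.s (ι p) = p.2
  central : ∀ c : C, ∀ᵐ g ∂(𝒢.arrowMeasure μ),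
    𝒢.mul g (ι (c, 𝒢.s g)) = 𝒢.mul (ι (c, 𝒢.r g)) g

/-- The element `gC` of the quotient `𝒢 / C`, as a subset of `𝒢`. -/
def centralCoset (𝒢 : DiscreteBorelGroupoid X G) (ι : C × X → G) (g : G) : Set G :=
  Set.range fun c : C => 𝒢.mul g (ι (c, 𝒢.s g))

/-- A (measurable) positive definite function on `𝒢`. -/
def IsPositiveDefinite (𝒢 : DiscreteBorelGroupoid X G) (μ : Measure X) (φ : G → ℂ) : Prop :=
  AEMeasurable φ (𝒢.arrowMeasure μ) ∧
    ∀ᵐ x ∂μ, ∀ (n : ℕ) (g : Fin n → G) (lam : Fin n → ℂ), (∀ i, 𝒢.r (g i) = x) →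
      0 ≤ ∑ i, ∑ j, star (lam i) * lam j * φ (𝒢.mul (𝒢.inv (g i)) (g j))

/-- A function on `𝒢` with value `1` at the unit `e_x` for almost every `x`. -/
def IsNormalized (𝒢 : DiscreteBorelGroupoid X G) (μ : Measure X) (φ : G → ℂ) : Prop :=
  ∀ᵐ x ∂μ, φ (𝒢.unit x) = 1

/-- For a function `φ` on `𝒢` such that `|φ|` is invariant under multiplication by `C`: the function
on `𝒢 / C` induced by `|φ|` is `c₀`. The set required to be finite is the set of elements of
`((𝒢 / C)|_Y)_x` at which that function is larger than `ε`. -/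
def IsC0ModCentral (𝒢 : DiscreteBorelGroupoid X G) (μ : Measure X) (ι : C × X → G)
    (φ : G → ℂ) : Prop :=
  ∀ δ : ℝ, 0 < δ → ∀ ε : ℝ, 0 < ε → ∃ Y : Set X, NullMeasurableSet Y μ ∧
    μ Yᶜ < ENNReal.ofReal δ ∧
    ∀ᵐ x ∂μ, x ∈ Y →
      (𝒢.centralCoset ι '' {g | 𝒢.s g = x ∧ 𝒢.r g ∈ Y ∧ ε < ‖φ g‖}).Finite

/-- The generalized Haagerup property of the pair `(𝒢, (C, ι))`. The values `φ n χ` for `χ ∉ V n`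
play no role. -/
def HasGHAP [Group C] [TopologicalSpace C] (𝒢 : DiscreteBorelGroupoid X G) (μ : Measure X)
    (ι : C × X → G) : Prop :=
  ∃ (V : ℕ → Set (PontryaginDual C)) (φ : ℕ → PontryaginDual C → G → ℂ),
    (∀ n, IsCompact (V n) ∧ V n ∈ 𝓝 1) ∧
    (∀ n, ∀ χ ∈ V n, 𝒢.IsPositiveDefinite μ (φ n χ) ∧ 𝒢.IsNormalized μ (φ n χ)) ∧
    (∀ᵐ g ∂(𝒢.arrowMeasure μ), ∀ ε : ℝ, 0 < ε →
      ∃ N : ℕ, ∀ n ≥ N, ∀ χ ∈ V n, ‖φ n χ g - 1‖ < ε) ∧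
    (∀ n, ∀ χ ∈ V n, ∀ᵐ g ∂(𝒢.arrowMeasure μ), ∀ c : C,
      φ n χ (𝒢.mul g (ι (c, 𝒢.s g))) = φ n χ g * (χ c : ℂ)) ∧
    (∀ n, ∀ᵐ g ∂(𝒢.arrowMeasure μ), ContinuousOn (fun χ => φ n χ g) (V n)) ∧
    (∀ n, ∀ χ ∈ V n, 𝒢.IsC0ModCentral μ ι (φ n χ))

end

end DiscreteBorelGroupoid

/-- A discrete countable group is amenable if it has a Følner sequence: non-empty finite sets `F n`
with `|g F n ∆ F n| / |F n| → 0` for every `g`. -/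
def IsAmenableGroup (A : Type*) [Group A] : Prop :=
  ∃ F : ℕ → Finset A, (∀ n, (F n).Nonempty) ∧
    ∀ g : A, Tendsto
      (fun n => ((symmDiff (g • (F n : Set A)) (F n : Set A)).ncard : ℝ) / ((F n).card : ℝ))
      atTop (𝓝 0)

end

/-! The property is induced from `𝒮` to `𝒢` by averaging over Følner sets, along sections that are
equivariant for `α`. Fix an injection of `A` into `ℕ`, and for `b : A` and a unit `x` let `τ b x` be
an arrow with range `x` for which `b⁻¹ * α (τ b x)` has the smallest code. The value `b` itself need
not be attained on the fibre. What matters is that left multiplication by `g` maps the range fibre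
over `s g` onto the one over `r g` and shifts `α` by `α g`, so the minimisation commutes with it
(`α_minimalSection`). Hence `transport`, which sends `g` to `τ (α g * a) (r g)⁻¹ * g * τ a (s g)`,
takes values in `ker α = 𝒮`; it is a cocycle in `a` and `g` and commutes with `C`.

For `ψ` on `𝒮` and a finite set `F`, `folnerAverage` is the mean over `a ∈ F` of `ψ (transport a
g)`, with zero in place of the terms for which `α g * a` leaves `F`. The substitution `b = α (g j) *
a` splits the matrix of this function at the arrows `(g i)⁻¹ * g j` into a sum of matrices of `ψ`,
which gives positivity (`folnerAverage_nonneg`). The Følner condition bounds the missing terms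
(`norm_folnerAverage_sub_one_le`), and a diagonal choice of indices makes `ψ` close to `1` on all
arrows that occur for the `k`-th Følner set (`exists_subsequence`). For fixed `F`, off a set of
small measure, a large value of the average determines `g` modulo `C` up to finitely many
possibilities (`isC0ModCentral_folnerAverage`).

The measure theory rests on one fact: a measurable countable-to-one map is covered, over almost
every point, by countably many measurable partial sections (`exists_measurable_injOn_cover`). With
it, "almost every arrow" becomes "every arrow over almost every unit" (`ae_fiberCount_iff`), and
quasi-invariance yields an invariant conull set on which the algebraic relations hold exactly
(`exists_isRegularOn`). -/

noncomputable section

/-! ### Partial sections of countable-to-one maps, up to null sets -/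

/-- A family of measurable sets that is closed under countable unions has a member that contains
all others up to null sets. -/
theorem exists_mem_ae_maximal {X : Type*} [MeasurableSpace X] (μ : Measure X) [IsFiniteMeasure μ]
    (𝒲 : Set (Set X)) (hne : 𝒲.Nonempty) (hm : ∀ W ∈ 𝒲, MeasurableSet W)
    (hU : ∀ W : ℕ → Set X, (∀ n, W n ∈ 𝒲) → (⋃ n, W n) ∈ 𝒲) :
    ∃ W ∈ 𝒲, ∀ W' ∈ 𝒲, μ (W' \ W) = 0 := by
  obtain ⟨u, -, hu, hmem⟩ := exists_seq_tendsto_sSup (S := μ '' 𝒲) (hne.image _)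
    (OrderTop.bddAbove _)
  choose W hW hWu using hmem
  refine ⟨⋃ n, W n, hU W hW, fun W' hW' => ?_⟩
  have h1 : sSup (μ '' 𝒲) ≤ μ (⋃ n, W n) :=
    le_of_tendsto' hu fun n => (hWu n) ▸ measure_mono (Set.subset_iUnion W n)
  have h2 : (⋃ n, W n) ∪ W' ∈ 𝒲 := by
    have := hU (fun n => Nat.casesOn n W' W) (fun n => by cases n <;> simp [hW, hW'])
    convert this using 1
    ext x
    simp only [Set.mem_union, Set.mem_iUnion]
    constructor
    · rintro (⟨n, hn⟩ | h)
      · exact ⟨n + 1, hn⟩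
      · exact ⟨0, h⟩
    · rintro ⟨n | n, hn⟩
      · exact Or.inr hn
      · exact Or.inl ⟨n, hn⟩
  have h3 : μ ((⋃ n, W n) ∪ W') ≤ μ (⋃ n, W n) :=
    (le_sSup (Set.mem_image_of_mem μ h2)).trans h1
  have h4 : μ (W' \ ⋃ n, W n) = μ (((⋃ n, W n) ∪ W') \ ⋃ n, W n) := by
    rw [Set.union_sdiff_left]
  rw [h4, measure_sdiff Set.subset_union_left (hm _ (hU W hW)).nullMeasurableSet (measure_ne_top _ _)]
  exact tsub_eq_zero_of_le h3

/-- `Z` is covered, up to fibres over a null set, by countably many measurable sets on which `p` is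
injective. -/
def IsCountablySectioned {X Y : Type*} [MeasurableSpace X] [MeasurableSpace Y] (p : Y → X)
    (μ : Measure X) (Z : Set Y) : Prop :=
  ∃ 𝓑 : Set (Set Y), 𝓑.Countable ∧ (∀ B ∈ 𝓑, MeasurableSet B ∧ Set.InjOn p B) ∧
    ∀ᵐ x ∂μ, ∀ y ∈ Z, p y = x → ∃ B ∈ 𝓑, y ∈ B

namespace IsCountablySectioned

variable {X Y : Type*} [MeasurableSpace X] [MeasurableSpace Y] {p : Y → X} {μ : Measure X}

theorem of_injOn {Z : Set Y} (hZ : MeasurableSet Z) (hi : Set.InjOn p Z) :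
    IsCountablySectioned p μ Z :=
  ⟨{Z}, Set.countable_singleton _, by simpa using ⟨hZ, hi⟩,
    ae_of_all _ fun _ y hy _ => ⟨Z, rfl, hy⟩⟩

theorem mono {Z Z' : Set Y} (h : IsCountablySectioned p μ Z) (hs : Z' ⊆ Z) :
    IsCountablySectioned p μ Z' := by
  obtain ⟨𝓑, h1, h2, h3⟩ := h
  exact ⟨𝓑, h1, h2, h3.mono fun x hx y hy => hx y (hs hy)⟩

theorem iUnion {ι : Type*} [Countable ι] {Z : ι → Set Y}
    (h : ∀ i, IsCountablySectioned p μ (Z i)) : IsCountablySectioned p μ (⋃ i, Z i) := by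
  choose 𝓑 h1 h2 h3 using h
  refine ⟨⋃ i, 𝓑 i, Set.countable_iUnion h1, ?_, ?_⟩
  · intro B hB
    obtain ⟨i, hi⟩ := Set.mem_iUnion.1 hB
    exact h2 i B hi
  · filter_upwards [ae_all_iff.2 h3] with x hx y hy hyx
    obtain ⟨i, hi⟩ := Set.mem_iUnion.1 hy
    obtain ⟨B, hB, hyB⟩ := hx i y hi hyx
    exact ⟨B, Set.mem_iUnion.2 ⟨i, hB⟩, hyB⟩

theorem union {Z Z' : Set Y} (h : IsCountablySectioned p μ Z) (h' : IsCountablySectioned p μ Z') :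
    IsCountablySectioned p μ (Z ∪ Z') := by
  rw [Set.union_eq_iUnion]
  exact iUnion fun b => by cases b <;> assumption

/-- The admissible bases are stable under countable unions, so exhaustion applies. Outside `W` no
base of positive measure makes `U` sectioned; the Cantor scheme grows there. -/
theorem exists_maximal_base [IsFiniteMeasure μ] (U : Set Y) :
    ∃ W : Set X, MeasurableSet W ∧ IsCountablySectioned p μ (U ∩ p ⁻¹' W) ∧
      ∀ W' : Set X, MeasurableSet W' → IsCountablySectioned p μ (U ∩ p ⁻¹' W') → μ (W' \ W) = 0 := by
  obtain ⟨W, hW, hmax⟩ := exists_mem_ae_maximal μ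
    {W | MeasurableSet W ∧ IsCountablySectioned p μ (U ∩ p ⁻¹' W)}
    ⟨∅, MeasurableSet.empty, by
      simpa using of_injOn (μ := μ) MeasurableSet.empty (Set.injOn_empty p)⟩
    (fun _ hW => hW.1) (fun W hW => ⟨MeasurableSet.iUnion fun n => (hW n).1, by
      rw [Set.preimage_iUnion, Set.inter_iUnion]
      exact iUnion fun n => (hW n).2⟩)
  exact ⟨W, hW.1, hW.2, fun W' h1 h2 => hmax W' ⟨h1, h2⟩⟩

end IsCountablySectioned

/-- A system of sets in which every member that has `x` in the closure of its image contains two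
disjoint small members with the same property forces an uncountable fibre over `x`. -/
theorem not_countable_fiber_of_splitting {X Y : Type*} [MetricSpace X] [MetricSpace Y]
    [CompleteSpace Y] {p : Y → X} (hp : Continuous p) (x : X) (𝒰 : Set (Set Y)) (hne : 𝒰.Nonempty)
    (hcl : ∀ U ∈ 𝒰, x ∈ closure (p '' U))
    (hsplit : ∀ U ∈ 𝒰, ∀ n : ℕ, ∃ U₁ ∈ 𝒰, ∃ U₂ ∈ 𝒰, closure U₁ ⊆ U ∧ closure U₂ ⊆ U ∧
      Disjoint U₁ U₂ ∧ Metric.ediam U₁ ≤ (n + 1 : ENNReal)⁻¹ ∧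
      Metric.ediam U₂ ≤ (n + 1 : ENNReal)⁻¹) :
    ¬ (p ⁻¹' {x}).Countable := by
  intro hcount
  obtain ⟨U₀, hU₀⟩ := hne
  have hsplit' : ∀ (U : 𝒰) (n : ℕ), ∃ V : Bool → 𝒰, (∀ b, closure (V b : Set Y) ⊆ U) ∧
      Disjoint (V true : Set Y) (V false) ∧
      ∀ b, Metric.ediam (V b : Set Y) ≤ (n + 1 : ENNReal)⁻¹ := by
    rintro ⟨U, hU⟩ n
    obtain ⟨U₁, h₁, U₂, h₂, c₁, c₂, d, e₁, e₂⟩ := hsplit U hU n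
    refine ⟨fun b => if b then ⟨U₁, h₁⟩ else ⟨U₂, h₂⟩, ?_, ?_, ?_⟩
    · rintro (_ | _)
      · exact c₂
      · exact c₁
    · exact d
    · rintro (_ | _)
      · exact e₂
      · exact e₁
  choose V hV1 hV2 hV3 using hsplit'
  -- A node at depth `n` is split into pieces of diameter at most `1 / (n + 1)`, so diameters vanish
  -- along every branch.
  let A' : List Bool → 𝒰 := fun l =>
    List.rec (motive := fun _ => 𝒰) ⟨U₀, hU₀⟩ (fun b l U => V U l.length b) l
  let A : List Bool → Set Y := fun l => A' l
  have hcons : ∀ b l, A (b :: l) = V (A' l) l.length b := fun _ _ => rfl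
  have hanti : CantorScheme.ClosureAntitone A := fun l b => hV1 _ _ _
  have hdisj : CantorScheme.Disjoint A := by
    intro l a b hab
    cases a <;> cases b <;> first | exact absurd rfl hab | skip
    · exact (hV2 _ _).symm
    · exact hV2 _ _
  have hdiam : CantorScheme.VanishingDiam A := by
    intro z
    rw [← tendsto_add_atTop_iff_nat 1]
    have hlim : Tendsto (fun n : ℕ => ((n : ENNReal) + 1)⁻¹) atTop (𝓝 0) := by
      have := (tendsto_add_atTop_iff_nat 1).2 ENNReal.tendsto_inv_nat_nhds_zero
      simpa using this
    refine tendsto_of_tendsto_of_tendsto_of_le_of_le tendsto_const_nhds hlim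
      (fun _ => zero_le) fun n => ?_
    have h := hV3 (A' (PiNat.res z n)) (PiNat.res z n).length (z n)
    rw [PiNat.res_length] at h
    simpa [PiNat.res_succ, hcons] using h
  have hnon : ∀ l, (A l).Nonempty := fun l => by
    have := hcl _ (A' l).2
    rw [Set.nonempty_iff_ne_empty]
    intro h0
    change x ∈ closure (p '' A l) at this
    simp [h0] at this
  have huniv := hanti.map_of_vanishingDiam hdiam hnon
  let F : (ℕ → Bool) → Y := fun z => (CantorScheme.inducedMap A).2 ⟨z, by rw [huniv]; trivial⟩
  have hF : Function.Injective F := fun z w h => by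
    simpa using hdisj.map_injective h
  have hmem : ∀ z n, F z ∈ A (PiNat.res z n) := fun z n =>
    CantorScheme.map_mem (A := A) ⟨z, by rw [huniv]; trivial⟩ n
  have hfib : ∀ z, p (F z) = x := by
    intro z
    refine eq_of_forall_dist_le fun ε hε => ?_
    obtain ⟨δ, hδ, hpδ⟩ := Metric.continuousAt_iff.1 (hp.continuousAt (x := F z)) ε hε
    obtain ⟨n, hn⟩ := hdiam.dist_lt δ hδ z
    -- By continuity a small node around `F z` has its image near `p (F z)`; since `x` lies in the
    -- closure of that image, `x` is near `p (F z)` too.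
    have hsub : p '' A (PiNat.res z n) ⊆ Metric.closedBall (p (F z)) ε := by
      rintro _ ⟨y, hy, rfl⟩
      exact (hpδ (hn y hy _ (hmem z n))).le
    have := closure_minimal hsub Metric.isClosed_closedBall (hcl _ (A' (PiNat.res z n)).2)
    rwa [Metric.mem_closedBall, dist_comm] at this
  have : (Set.univ : Set (ℕ → Bool)).Countable :=
    (hcount.preimage hF).mono fun z _ => hfib z
  have hle := Cardinal.mk_le_aleph0_iff.2 (Set.countable_univ_iff.1 this)
  simp only [Cardinal.mk_pi, Cardinal.mk_bool, Cardinal.prod_const, Cardinal.lift_id,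
    Cardinal.mk_nat] at hle
  exact absurd hle (not_le.2 (Cardinal.cantor _))

/-- For each basic open `U` take the maximal base `W U` over which `U` is sectioned. If `x` is
generic and misses some `W U`, then `U` contains two disjoint small basic sets whose maximal bases
also miss `x`. Iterating gives a Cantor set in the fibre over `x`, against countability. So almost
every `x` lies in all the `W U`. -/
theorem isCountablySectioned_univ_of_continuous {X Y : Type*} [MetricSpace X]
    [MeasurableSpace X] [BorelSpace X] [MetricSpace Y] [CompleteSpace Y]
    [SecondCountableTopology Y] [MeasurableSpace Y] [BorelSpace Y] (μ : Measure X)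
    [IsFiniteMeasure μ] {p : Y → X} (hp : Continuous p) (hc : ∀ x, (p ⁻¹' {x}).Countable) :
    IsCountablySectioned p μ Set.univ := by
  obtain ⟨b, hbc, -, hb⟩ := TopologicalSpace.exists_countable_basis Y
  have : Countable b := hbc.to_subtype
  have hpm := hp.measurable
  choose W hWm hWs hWmax using IsCountablySectioned.exists_maximal_base (p := p) (μ := μ)
  let R : Set Y := ⋃ U : b, (U : Set Y) ∩ p ⁻¹' W U
  have hR : IsCountablySectioned p μ R := IsCountablySectioned.iUnion fun U => hWs U
  have hRm : MeasurableSet R :=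
    MeasurableSet.iUnion fun U => (hb.isOpen U.2).measurableSet.inter (hpm (hWm U))
  have hcl : ∀ᵐ x ∂μ, ∀ U : b, x ∉ W U → x ∈ closure (p '' U) := by
    rw [ae_all_iff]
    intro U
    -- `U` has no points over the complement of the closure of its image, so maximality absorbs that
    -- complement into `W U`.
    have hm : MeasurableSet (closure (p '' (U : Set Y)))ᶜ := isClosed_closure.measurableSet.compl
    have := hWmax U _ hm (by
      convert IsCountablySectioned.of_injOn MeasurableSet.empty (Set.injOn_empty p)
      rw [Set.eq_empty_iff_forall_notMem]
      rintro y ⟨hy, hy'⟩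
      exact hy' (subset_closure ⟨y, hy, rfl⟩))
    refine measure_mono_null (fun x hx => ?_) this
    simp only [Set.mem_compl_iff, Set.mem_ofPred_eq] at hx
    push Not at hx
    exact ⟨hx.2, hx.1⟩
  have hsplit : ∀ᵐ x ∂μ, ∀ (U : b) (n : ℕ), x ∉ W U → ∃ U₁ : b, ∃ U₂ : b,
      (closure (U₁ : Set Y) ⊆ U ∧ closure (U₂ : Set Y) ⊆ U ∧
      Disjoint (U₁ : Set Y) U₂ ∧ Metric.ediam (U₁ : Set Y) ≤ (n + 1 : ENNReal)⁻¹ ∧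
      Metric.ediam (U₂ : Set Y) ≤ (n + 1 : ENNReal)⁻¹) ∧ x ∉ W U₁ ∧ x ∉ W U₂ := by
    rw [ae_all_iff]
    intro U
    rw [ae_all_iff]
    intro n
    let T : Set (b × b) := {q | closure (q.1 : Set Y) ⊆ U ∧ closure (q.2 : Set Y) ⊆ U ∧
      Disjoint (q.1 : Set Y) q.2 ∧ Metric.ediam (q.1 : Set Y) ≤ (n + 1 : ENNReal)⁻¹ ∧
      Metric.ediam (q.2 : Set Y) ≤ (n + 1 : ENNReal)⁻¹}
    -- The points at which no admissible pair splits `U`. It suffices that `U` is sectioned over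
    -- `W'`, for then `W'` is contained in `W U` up to a null set.
    let W' : Set X := ⋂ q ∈ T, (W q.1 ∪ W q.2)
    have hW'm : MeasurableSet W' :=
      MeasurableSet.biInter (Set.to_countable T) fun q _ => (hWm _).union (hWm _)
    have hsmall : ∀ y ∈ (U : Set Y), ∀ O : Set Y, IsOpen O → y ∈ O →
        ∃ V : b, y ∈ (V : Set Y) ∧ (V : Set Y) ⊆ O ∧ closure (V : Set Y) ⊆ U ∧
          Metric.ediam (V : Set Y) ≤ (n + 1 : ENNReal)⁻¹ := by
      intro y hy O hO hyO
      obtain ⟨ε, hε, hεU⟩ := Metric.nhds_basis_closedBall.mem_iff.1 ((hb.isOpen U.2).mem_nhds hy)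
      have hpos : (0 : ℝ) < 1 / (2 * (n + 1)) := by positivity
      obtain ⟨V, hV, hyV, hVs⟩ := hb.exists_subset_of_mem_open
        (show y ∈ O ∩ Metric.ball y (min ε (1 / (2 * (n + 1)))) from
          ⟨hyO, Metric.mem_ball_self (lt_min hε hpos)⟩) (hO.inter Metric.isOpen_ball)
      have hVb : V ⊆ Metric.closedBall y (min ε (1 / (2 * (n + 1)))) :=
        (hVs.trans Set.inter_subset_right).trans Metric.ball_subset_closedBall
      refine ⟨⟨V, hV⟩, hyV, hVs.trans Set.inter_subset_left,
        (closure_minimal hVb Metric.isClosed_closedBall).trans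
          ((Metric.closedBall_subset_closedBall (min_le_left _ _)).trans hεU), ?_⟩
      have h1 : V ⊆ Metric.closedEBall y (ENNReal.ofReal (1 / (2 * (n + 1)))) := by
        rw [Metric.closedEBall_ofReal hpos.le]
        exact hVb.trans (Metric.closedBall_subset_closedBall (min_le_right _ _))
      refine (Metric.ediam_mono h1).trans (Metric.ediam_closedEBall_le.trans_eq ?_)
      rw [show (2 : ENNReal) = ENNReal.ofReal 2 by simp, ← ENNReal.ofReal_mul (by norm_num),
        show (2 : ℝ) * (1 / (2 * (n + 1))) = (n + 1 : ℝ)⁻¹ by field_simp,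
        ENNReal.ofReal_inv_of_pos (by positivity), ENNReal.ofReal_add (by positivity) zero_le_one]
      simp
    -- Two distinct points of one fibre are separated by an admissible pair; over `W'` one member of
    -- the pair is already sectioned there, which puts its point into `R`.
    have hinj : Set.InjOn p (((U : Set Y) ∩ p ⁻¹' W') \ R) := by
      rintro y ⟨⟨hyU, hyW⟩, hyR⟩ z ⟨⟨hzU, hzW⟩, hzR⟩ hyz
      by_contra hne
      obtain ⟨O₁, O₂, hO₁, hO₂, hyO, hzO, hO⟩ := t2_separation hne
      obtain ⟨U₁, hy₁, hs₁, hc₁, hd₁⟩ := hsmall y hyU O₁ hO₁ hyO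
      obtain ⟨U₂, hz₂, hs₂, hc₂, hd₂⟩ := hsmall z hzU O₂ hO₂ hzO
      have hT : (U₁, U₂) ∈ T := ⟨hc₁, hc₂, hO.mono hs₁ hs₂, hd₁, hd₂⟩
      rcases Set.mem_iInter₂.1 hyW _ hT with h | h
      · exact hyR (Set.mem_iUnion.2 ⟨U₁, hy₁, h⟩)
      · exact hzR (Set.mem_iUnion.2 ⟨U₂, hz₂, by rwa [Set.mem_preimage, ← hyz]⟩)
    have hs : IsCountablySectioned p μ ((U : Set Y) ∩ p ⁻¹' W') :=
      ((IsCountablySectioned.of_injOn ((((hb.isOpen U.2).measurableSet.inter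
        (hpm hW'm))).diff hRm) hinj).union hR).mono fun y hy => by
          by_cases h : y ∈ R
          · exact Or.inr h
          · exact Or.inl ⟨hy, h⟩
    refine measure_mono_null (fun x hx => ?_) (hWmax U W' hW'm hs)
    simp only [Set.mem_compl_iff, Set.mem_ofPred_eq] at hx
    push Not at hx
    refine ⟨Set.mem_iInter₂.2 fun q hq => ?_, hx.1⟩
    have := hx.2 q.1 q.2 hq
    by_cases h : x ∈ W q.1
    · exact Or.inl h
    · exact Or.inr (this h)
  have hall : ∀ᵐ x ∂μ, ∀ U : b, x ∈ W U := by
    filter_upwards [hcl, hsplit] with x h1 h2 U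
    by_contra hU
    refine not_countable_fiber_of_splitting hp x {V | V ∈ b ∧ x ∉ W V} ⟨U, U.2, hU⟩
      (fun V hV => h1 ⟨V, hV.1⟩ hV.2) (fun V hV n => ?_) (hc x)
    obtain ⟨U₁, U₂, h, h', h''⟩ := h2 ⟨V, hV.1⟩ n hV.2
    exact ⟨U₁, ⟨U₁.2, h'⟩, U₂, ⟨U₂.2, h''⟩, h⟩
  obtain ⟨𝓑, h1, h2, h3⟩ := hR
  refine ⟨𝓑, h1, h2, ?_⟩
  filter_upwards [h3, hall] with x hx hx' y _ hyx
  obtain ⟨U, hU, hyU, -⟩ := hb.exists_subset_of_mem_open (Set.mem_univ y) isOpen_univ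
  refine hx y (Set.mem_iUnion.2 ⟨⟨U, hU⟩, hyU, ?_⟩) hyx
  have := hx' ⟨U, hU⟩
  rwa [← hyx] at this

theorem isCountablySectioned_univ_of_polish {X Y : Type*} [TopologicalSpace X] [PolishSpace X]
    [MeasurableSpace X] [BorelSpace X] [TopologicalSpace Y] [PolishSpace Y]
    [MeasurableSpace Y] [BorelSpace Y] (μ : Measure X)
    [IsFiniteMeasure μ] {p : Y → X} (hp : Continuous p) (hc : ∀ x, (p ⁻¹' {x}).Countable) :
    IsCountablySectioned p μ Set.univ := by
  let := TopologicalSpace.upgradeIsCompletelyMetrizable X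
  let := TopologicalSpace.upgradeIsCompletelyMetrizable Y
  exact isCountablySectioned_univ_of_continuous μ hp hc

/-- A measurable countable-to-one map is injective on each of countably many measurable sets
that cover almost all fibres. -/
theorem exists_measurable_injOn_cover {X Y : Type*} [MeasurableSpace X] [StandardBorelSpace X]
    [MeasurableSpace Y] [StandardBorelSpace Y] (μ : Measure X) [IsFiniteMeasure μ] {p : Y → X}
    (hp : Measurable p) (hc : ∀ x, (p ⁻¹' {x}).Countable) :
    ∃ B : ℕ → Set Y, (∀ k, MeasurableSet (B k)) ∧ (∀ k, Set.InjOn p (B k)) ∧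
      ∀ᵐ x ∂μ, ∀ y, p y = x → ∃ k, y ∈ B k := by
  have key : IsCountablySectioned p μ Set.univ := by
    let := upgradeStandardBorel X
    let iY := upgradeStandardBorel Y
    obtain ⟨t', ht', hcont, hpol⟩ := hp.exists_continuous
    -- The finer Polish topology that makes `p` continuous generates the same Borel sets.
    have hbor : @BorelSpace Y t' _ :=
      @BorelSpace.mk _ t' _ (iY.toBorelSpace.measurable_eq.trans
        (borel_eq_borel_of_le hpol iY.toPolishSpace ht').symm)
    exact isCountablySectioned_univ_of_polish μ hcont hc
  obtain ⟨𝓑, h1, h2, h3⟩ := key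
  obtain ⟨B, hB⟩ := (h1.insert ∅).exists_eq_range (Set.insert_nonempty _ _)
  have hBmem : ∀ k, MeasurableSet (B k) ∧ Set.InjOn p (B k) := by
    intro k
    have : B k ∈ insert ∅ 𝓑 := hB ▸ Set.mem_range_self k
    rcases this with h | h
    · rw [h]
      exact ⟨MeasurableSet.empty, Set.injOn_empty p⟩
    · exact h2 _ h
  refine ⟨B, fun k => (hBmem k).1, fun k => (hBmem k).2, h3.mono fun x hx y hy => ?_⟩
  obtain ⟨Z, hZ, hyZ⟩ := hx y trivial hy
  have : Z ∈ Set.range B := hB ▸ Set.mem_insert_of_mem _ hZ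
  obtain ⟨k, rfl⟩ := this
  exact ⟨k, hyZ⟩

/-! ### Null sets of the fibrewise counting measure -/

/-- Countably many measurable partial sections of `p` exhaust almost all fibres. -/
def HasMeasurableSections {X Y : Type*} [MeasurableSpace X] [MeasurableSpace Y] (p : Y → X)
    (μ : Measure X) : Prop :=
  ∃ B : ℕ → Set Y, (∀ k, MeasurableSet (B k)) ∧ Pairwise (Function.onFun Disjoint B) ∧
    (∀ k, Set.InjOn p (B k)) ∧
    (∀ k E, MeasurableSet E → MeasurableSet (p '' (B k ∩ E))) ∧
    ∀ᵐ x ∂μ, ∀ y, p y = x → ∃ k, y ∈ B k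

section

variable {X Y : Type*} [MeasurableSpace X] [MeasurableSpace Y] {p : Y → X} {μ : Measure X}

theorem hasMeasurableSections_of_countable_fiber [StandardBorelSpace X] [StandardBorelSpace Y]
    [IsFiniteMeasure μ] (hp : Measurable p) (hc : ∀ x, (p ⁻¹' {x}).Countable) :
    HasMeasurableSections p μ := by
  obtain ⟨B, h1, h2, h3⟩ := exists_measurable_injOn_cover μ hp hc
  refine ⟨disjointed B, MeasurableSet.disjointed h1, disjoint_disjointed B,
    fun k => (h2 k).mono (disjointed_subset B k), fun k E hE => ?_, ?_⟩
  · exact ((MeasurableSet.disjointed h1 k).inter hE).image_of_measurable_injOn hp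
      ((h2 k).mono (Set.inter_subset_left.trans (disjointed_subset B k)))
  · filter_upwards [h3] with x hx y hy
    have : y ∈ ⋃ k, disjointed B k := by
      rw [iUnion_disjointed]
      exact Set.mem_iUnion.2 (hx y hy)
    exact Set.mem_iUnion.1 this

/-- On a partial section, counting in the fibre over `x` is the indicator of the image, and images
of measurable sets are measurable. Without this, `Measure.bind` in `fiberCount` could not be
evaluated. -/
theorem HasMeasurableSections.aemeasurable [MeasurableSingletonClass X] (hp : Measurable p)
    (h : HasMeasurableSections p μ) :
    AEMeasurable (fun x => Measure.count.restrict (p ⁻¹' {x}) : X → Measure Y) μ := by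
  obtain ⟨B, h1, h2, h3, h4, h5⟩ := h
  -- The measurable representative counts only points on the sections, which lose something only
  -- over a null set.
  refine ⟨fun x => Measure.count.restrict (⋃ k, B k ∩ p ⁻¹' {x}), ?_, ?_⟩
  · refine Measure.measurable_of_measurable_coe _ fun E hE => ?_
    have hfib : ∀ x, MeasurableSet (p ⁻¹' {x}) := fun x => hp (measurableSet_singleton x)
    have heq : ∀ x, (Measure.count.restrict (⋃ k, B k ∩ p ⁻¹' {x}) : Measure Y) E =
        ∑' k, (p '' (B k ∩ E)).indicator 1 x := by
      intro x
      rw [Measure.restrict_apply hE, Set.inter_iUnion, measure_iUnion]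
      · refine tsum_congr fun k => ?_
        by_cases hx : x ∈ p '' (B k ∩ E)
        · obtain ⟨y, hy, rfl⟩ := hx
          rw [Set.indicator_of_mem (Set.mem_image_of_mem p hy)]
          have : E ∩ (B k ∩ p ⁻¹' {p y}) = {y} := by
            ext z
            constructor
            · rintro ⟨-, hz, hzy⟩
              exact h3 k hz hy.1 hzy
            · rintro rfl
              exact ⟨hy.2, hy.1, rfl⟩
          rw [Measure.count_apply (hE.inter ((h1 k).inter (hfib _))), this]
          simp
        · rw [Set.indicator_of_notMem hx]
          have : E ∩ (B k ∩ p ⁻¹' {x}) = ∅ := by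
            rw [Set.eq_empty_iff_forall_notMem]
            rintro y ⟨hyE, hyB, hyx⟩
            exact hx ⟨y, ⟨hyB, hyE⟩, hyx⟩
          rw [this, measure_empty]
      · intro i j hij
        exact ((h2 hij).mono Set.inter_subset_left Set.inter_subset_left).mono
          Set.inter_subset_right Set.inter_subset_right
      · exact fun k => hE.inter ((h1 k).inter (hfib x))
    simp_rw [heq]
    exact Measurable.tsum fun k => measurable_one.indicator (h4 k E hE)
  · filter_upwards [h5] with x hx
    congr 1
    ext y
    simp only [Set.mem_iUnion, Set.mem_inter_iff]
    exact ⟨fun hy => (hx y hy).imp fun k hk => ⟨hk, hy⟩, fun ⟨k, _, hy⟩ => hy⟩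

/-- A property holds almost everywhere for the fibrewise counting measure if and only if it holds
on the whole of almost every fibre. -/
theorem HasMeasurableSections.ae_fiberCount_iff [MeasurableSingletonClass X] (hp : Measurable p)
    (h : HasMeasurableSections p μ) {P : Y → Prop} :
    (∀ᵐ y ∂fiberCount p μ, P y) ↔ ∀ᵐ x ∂μ, ∀ y, p y = x → P y := by
  have hnull : ∀ E : Set Y, MeasurableSet E →
      (fiberCount p μ E = 0 ↔ ∀ᵐ x ∂μ, ∀ y, p y = x → y ∉ E) := by
    intro E hE
    have hm := h.aemeasurable hp
    have hm' : AEMeasurable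
        (fun x => (Measure.count.restrict (p ⁻¹' {x}) : Measure Y) E) μ :=
      (Measure.measurable_coe hE).comp_aemeasurable hm
    rw [fiberCount, Measure.bind_apply hE hm, lintegral_eq_zero_iff' hm']
    refine eventually_congr (ae_of_all _ fun x => ?_)
    simp only [Pi.zero_apply]
    have hmx := hE.inter (hp (measurableSet_singleton x))
    rw [Measure.restrict_apply hE]
    constructor
    · intro h0 y hy hyE
      have h1 : (1 : ENNReal) ≤ Measure.count (E ∩ p ⁻¹' {x}) := by
        rw [Measure.count_apply hmx]
        exact_mod_cast (Set.one_le_encard_iff_nonempty (s := E ∩ p ⁻¹' {x})).2 ⟨y, hyE, hy⟩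
      simp [h0] at h1
    · intro h0
      have : E ∩ p ⁻¹' {x} = ∅ := by
        rw [Set.eq_empty_iff_forall_notMem]
        rintro y ⟨hyE, hy⟩
        exact h0 y hy hyE
      rw [this, measure_empty]
  constructor
  · intro hP
    have h0 : fiberCount p μ (toMeasurable (fiberCount p μ) {y | ¬ P y}) = 0 := by
      rw [measure_toMeasurable]
      exact hP
    filter_upwards [(hnull _ (measurableSet_toMeasurable _ _)).1 h0] with x hx y hy
    by_contra hPy
    exact hx y hy (subset_toMeasurable _ _ hPy)
  · intro hP
    let N := toMeasurable μ {x | ¬ ∀ y, p y = x → P y}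
    have hN : μ N = 0 := by
      rw [measure_toMeasurable]
      exact hP
    have h0 : fiberCount p μ (p ⁻¹' N) = 0 := by
      rw [hnull _ (hp (measurableSet_toMeasurable _ _))]
      have : ∀ᵐ x ∂μ, x ∉ N := measure_eq_zero_iff_ae_notMem.1 hN
      filter_upwards [this] with x hx y hy hyN
      exact hx (hy ▸ hyN)
    refine measure_mono_null (fun y hy => ?_) h0
    refine subset_toMeasurable μ _ ?_
    intro hall
    exact hy (hall y rfl)

end

/-! ### Almost-everywhere statements, invariant sets and enumerations in a measured groupoid -/

namespace DiscreteBorelGroupoid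

variable {X G : Type*} [MeasurableSpace X] [MeasurableSpace G]
  {𝒢 : DiscreteBorelGroupoid X G} {μ : Measure X}

theorem inv_inv (𝒢 : DiscreteBorelGroupoid X G) (g : G) : 𝒢.inv (𝒢.inv g) = g := by
  have h1 : 𝒢.mul (𝒢.mul (𝒢.inv (𝒢.inv g)) (𝒢.inv g)) g = g := by
    rw [𝒢.inv_mul, 𝒢.s_inv, 𝒢.unit_mul]
  rw [𝒢.mul_assoc _ _ _ (by rw [𝒢.s_inv]) (by rw [𝒢.s_inv]), 𝒢.inv_mul] at h1
  have h2 := 𝒢.mul_unit (𝒢.inv (𝒢.inv g))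
  rw [𝒢.s_inv, 𝒢.r_inv] at h2
  rw [← h2, h1]

theorem countable_source_fiber (𝒢 : DiscreteBorelGroupoid X G) (x : X) :
    (𝒢.s ⁻¹' {x}).Countable := by
  refine ((𝒢.countable_fiber x).image 𝒢.inv).mono fun g hg =>
    (Set.mem_image _ _ _).2 ⟨𝒢.inv g, ?_, 𝒢.inv_inv g⟩
  rw [Set.mem_preimage, 𝒢.r_inv]
  exact hg

theorem measurable_mul_of_composable {Ω : Type*} [MeasurableSpace Ω]
    (𝒢 : DiscreteBorelGroupoid X G) {f g : Ω → G} (hf : Measurable f) (hg : Measurable g)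
    (hc : ∀ ω, 𝒢.s (f ω) = 𝒢.r (g ω)) : Measurable fun ω => 𝒢.mul (f ω) (g ω) :=
  𝒢.measurable_mul.comp (f := fun ω => (⟨(f ω, g ω), hc ω⟩ : 𝒢.Composable))
    (hf.prodMk hg).subtype_mk

/-- The units are the fixed points of `g ↦ g⁻¹ * g`, a Borel set on which `r` is injective with
inverse `unit`. Preimages under `unit` are thus injective Borel images. -/
theorem measurable_unit [StandardBorelSpace X] [StandardBorelSpace G]
    (𝒢 : DiscreteBorelGroupoid X G) : Measurable 𝒢.unit := by
  intro E hE
  have hU : MeasurableSet {g | 𝒢.mul (𝒢.inv g) g = g} :=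
    measurableSet_eq_fun
      (𝒢.measurable_mul_of_composable 𝒢.measurable_inv measurable_id fun g => 𝒢.s_inv g)
      measurable_id
  have hunit : ∀ g, 𝒢.mul (𝒢.inv g) g = g → g = 𝒢.unit (𝒢.r g) := by
    intro g hg
    rw [𝒢.inv_mul] at hg
    rw [← hg, 𝒢.r_unit]
  have hmem : ∀ x, 𝒢.mul (𝒢.inv (𝒢.unit x)) (𝒢.unit x) = 𝒢.unit x := fun x => by
    rw [𝒢.inv_mul, 𝒢.s_unit]
  convert (hU.inter hE).image_of_measurable_injOn 𝒢.measurable_r (f := 𝒢.r) ?_ using 1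
  · ext x
    constructor
    · exact fun hx => ⟨𝒢.unit x, ⟨hmem x, hx⟩, 𝒢.r_unit x⟩
    · rintro ⟨g, ⟨hg, hgE⟩, rfl⟩
      rw [Set.mem_preimage, ← hunit g hg]
      exact hgE
  · rintro g ⟨hg, -⟩ k ⟨hk, -⟩ hgk
    rw [hunit g hg, hunit k hk, hgk]

variable [StandardBorelSpace X] [IsFiniteMeasure μ]

theorem hasMeasurableSections_s [StandardBorelSpace G] (𝒢 : DiscreteBorelGroupoid X G) :
    HasMeasurableSections 𝒢.s μ :=
  hasMeasurableSections_of_countable_fiber 𝒢.measurable_s 𝒢.countable_source_fiber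

theorem ae_arrowMeasure_iff [StandardBorelSpace G] {P : G → Prop} :
    (∀ᵐ g ∂𝒢.arrowMeasure μ, P g) ↔ ∀ᵐ x ∂μ, ∀ g, 𝒢.s g = x → P g :=
  𝒢.hasMeasurableSections_s.ae_fiberCount_iff 𝒢.measurable_s

theorem ae_pairMeasure_iff [StandardBorelSpace G] {P : 𝒢.Composable → Prop} :
    (∀ᵐ q ∂𝒢.pairMeasure μ, P q) ↔
      ∀ᵐ x ∂μ, ∀ (g h : G) (hc : 𝒢.s g = 𝒢.r h), 𝒢.s h = x → P ⟨(g, h), hc⟩ := by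
  have hms : MeasurableSet {q : G × G | 𝒢.s q.1 = 𝒢.r q.2} :=
    measurableSet_eq_fun (𝒢.measurable_s.comp measurable_fst)
      (𝒢.measurable_r.comp measurable_snd)
  have : StandardBorelSpace 𝒢.Composable := hms.standardBorel
  have hm : Measurable fun q : 𝒢.Composable => 𝒢.s q.1.2 :=
    𝒢.measurable_s.comp (measurable_snd.comp measurable_subtype_coe)
  have hc : ∀ x, ((fun q : 𝒢.Composable => 𝒢.s q.1.2) ⁻¹' {x}).Countable := by
    intro x
    have h1 : (⋃ h ∈ 𝒢.s ⁻¹' {x}, (fun g => (g, h)) '' (𝒢.s ⁻¹' {𝒢.r h})).Countable :=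
      (𝒢.countable_source_fiber x).biUnion fun h _ => (𝒢.countable_source_fiber _).image _
    refine (h1.preimage (f := (Subtype.val : 𝒢.Composable → G × G))
      Subtype.val_injective).mono ?_
    rintro ⟨⟨g, h⟩, hgh⟩ hx
    exact Set.mem_biUnion (x := h) hx ⟨g, hgh, rfl⟩
  rw [pairMeasure, (hasMeasurableSections_of_countable_fiber hm hc).ae_fiberCount_iff hm]
  refine eventually_congr (ae_of_all _ fun x => ?_)
  exact ⟨fun h g k hc hx => h _ hx, fun h q hx => h _ _ q.2 hx⟩

/-- Since `𝒮` is only null-measurable, its arrow space need not be standard Borel. The sections come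
from `𝒢` instead, cut down to a measurable subset of `𝒮` of full measure. -/
theorem Subgroupoid.ae_arrowMeasure_iff [StandardBorelSpace G] {𝒮 : 𝒢.Subgroupoid}
    (h𝒮 : NullMeasurableSet 𝒮.carrier (𝒢.arrowMeasure μ)) {P : 𝒮.carrier → Prop} :
    (∀ᵐ g ∂𝒮.toGroupoid.arrowMeasure μ, P g) ↔
      ∀ᵐ x ∂μ, ∀ g : 𝒮.carrier, 𝒢.s g = x → P g := by
  refine HasMeasurableSections.ae_fiberCount_iff 𝒮.toGroupoid.measurable_s ?_
  obtain ⟨B, h1, h2, h3, h4, h5⟩ := 𝒢.hasMeasurableSections_s (μ := μ)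
  obtain ⟨S, hS, hSm, hSe⟩ := h𝒮.exists_measurable_subset_ae_eq
  refine ⟨fun k => Subtype.val ⁻¹' (B k ∩ S),
    fun k => measurable_subtype_coe ((h1 k).inter hSm), fun i j hij => ?_, fun k => ?_, ?_, ?_⟩
  · exact ((h2 hij).mono Set.inter_subset_left Set.inter_subset_left).preimage _
  · exact fun g hg k hk hgk => Subtype.ext (h3 _ hg.1 hk.1 hgk)
  · rintro k _ ⟨E, hE, rfl⟩
    convert h4 k (S ∩ E) (hSm.inter hE) using 1
    ext x
    constructor
    · rintro ⟨g, ⟨⟨h, h'⟩, h''⟩, rfl⟩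
      exact ⟨g, ⟨h, h', h''⟩, rfl⟩
    · rintro ⟨g, ⟨h, h', h''⟩, rfl⟩
      exact ⟨⟨g, hS h'⟩, ⟨⟨h, h'⟩, h''⟩, rfl⟩
  · filter_upwards [h5, DiscreteBorelGroupoid.ae_arrowMeasure_iff.1 hSe.mem_iff] with x hx hx' g hg
    obtain ⟨k, hk⟩ := hx g hg
    exact ⟨k, hk, (hx' g hg).2 g.2⟩

/-- For a quasi-invariant measure, almost every orbit lies in a given conull set. -/
theorem IsQuasiInvariant.ae_orbit [StandardBorelSpace G] (h : 𝒢.IsQuasiInvariant μ)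
    {P : X → Prop} (hP : ∀ᵐ x ∂μ, P x) : ∀ᵐ x ∂μ, ∀ g, 𝒢.s g = x → P (𝒢.r g) := by
  have h1 : ∀ᵐ g ∂𝒢.arrowMeasure μ, P (𝒢.s g) :=
    ae_arrowMeasure_iff.2 (hP.mono fun x hx g hg => hg ▸ hx)
  have h2 := ae_of_ae_map 𝒢.measurable_inv.aemeasurable (h.2.ae_le h1)
  simpa only [𝒢.s_inv] using ae_arrowMeasure_iff.1 h2

/-- The units whose whole orbit satisfies `P` form an invariant set, which is conull by
quasi-invariance. -/
theorem IsQuasiInvariant.exists_invariant [StandardBorelSpace G] (h : 𝒢.IsQuasiInvariant μ)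
    {P : X → Prop} (hP : ∀ᵐ x ∂μ, P x) :
    ∃ X₀ : Set X, (∀ᵐ x ∂μ, x ∈ X₀) ∧ (∀ x ∈ X₀, P x) ∧ ∀ g, 𝒢.s g ∈ X₀ ↔ 𝒢.r g ∈ X₀ := by
  refine ⟨{x | ∀ g, 𝒢.s g = x → P (𝒢.r g)}, h.ae_orbit hP, fun x hx => ?_, ?_⟩
  · simpa only [𝒢.r_unit] using hx (𝒢.unit x) (𝒢.s_unit x)
  · have key : ∀ g, (∀ k, 𝒢.s k = 𝒢.s g → P (𝒢.r k)) → ∀ k, 𝒢.s k = 𝒢.r g → P (𝒢.r k) := by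
      intro g hg k hk
      have := hg (𝒢.mul k g) (𝒢.s_mul _ _ hk)
      rwa [𝒢.r_mul _ _ hk] at this
    refine fun g => ⟨key g, fun hg => ?_⟩
    have := key (𝒢.inv g)
    rw [𝒢.s_inv, 𝒢.r_inv] at this
    exact this hg

/-- Measurable sections of the range map that enumerate almost every fibre. -/
theorem exists_enumeration [StandardBorelSpace G] (𝒢 : DiscreteBorelGroupoid X G)
    (μ : Measure X) [IsFiniteMeasure μ] :
    ∃ t : ℕ → X → G, (∀ k, Measurable (t k)) ∧ (∀ k x, 𝒢.r (t k x) = x) ∧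
      ∀ᵐ x ∂μ, ∀ g, 𝒢.r g = x → ∃ k, g = t k x := by
  classical
  obtain ⟨B, h1, -, h3, h4, h5⟩ := hasMeasurableSections_of_countable_fiber (μ := μ)
    𝒢.measurable_r 𝒢.countable_fiber
  -- The default is the unit, so that `t k x` has range `x` without exception.
  let t : ℕ → X → G := fun k x => if h : x ∈ 𝒢.r '' B k then h.choose else 𝒢.unit x
  have hpos : ∀ k g, g ∈ B k → t k (𝒢.r g) = g := by
    intro k g hg
    have h : 𝒢.r g ∈ 𝒢.r '' B k := ⟨g, hg, rfl⟩
    simp only [t, dif_pos h]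
    exact h3 k h.choose_spec.1 hg h.choose_spec.2
  have hneg : ∀ k x, x ∉ 𝒢.r '' B k → t k x = 𝒢.unit x := fun k x hx => dif_neg hx
  refine ⟨t, fun k E hE => ?_, fun k x => ?_, ?_⟩
  · have : t k ⁻¹' E = 𝒢.r '' (B k ∩ E) ∪ (𝒢.unit ⁻¹' E \ 𝒢.r '' B k) := by
      ext x
      by_cases hx : x ∈ 𝒢.r '' B k
      · simp only [Set.mem_union, Set.mem_sdiff, hx, not_true, and_false, or_false]
        obtain ⟨g, hg, rfl⟩ := hx
        rw [Set.mem_preimage, hpos k g hg]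
        refine ⟨fun h => ⟨g, ⟨hg, h⟩, rfl⟩, ?_⟩
        rintro ⟨g', ⟨hg', hE'⟩, he⟩
        rwa [← h3 k hg' hg he]
      · simp only [Set.mem_union, Set.mem_sdiff, hx, not_false_eq_true, and_true,
          Set.mem_preimage, hneg k x hx]
        refine ⟨Or.inr, ?_⟩
        rintro (⟨g, ⟨hg, -⟩, rfl⟩ | h)
        · exact absurd ⟨g, hg, rfl⟩ hx
        · exact h
    rw [this]
    refine (h4 k E hE).union ((𝒢.measurable_unit hE).diff ?_)
    simpa using h4 k Set.univ MeasurableSet.univ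
  · by_cases hx : x ∈ 𝒢.r '' B k
    · obtain ⟨g, hg, rfl⟩ := hx
      rw [hpos k g hg]
    · rw [hneg k x hx, 𝒢.r_unit]
  · filter_upwards [h5] with x hx g hg
    obtain ⟨k, hk⟩ := hx g hg
    exact ⟨k, by rw [← hg, hpos k g hk]⟩

end DiscreteBorelGroupoid

/-! ### Equivariant sections and transport into the kernel -/

namespace DiscreteBorelGroupoid

variable {X G : Type*} [MeasurableSpace X] [MeasurableSpace G] (𝒢 : DiscreteBorelGroupoid X G)

theorem inv_mul_cancel_left {g h : G} (hc : 𝒢.s g = 𝒢.r h) :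
    𝒢.mul (𝒢.inv g) (𝒢.mul g h) = h := by
  rw [← 𝒢.mul_assoc _ _ _ (𝒢.s_inv g) hc, 𝒢.inv_mul, hc, 𝒢.unit_mul]

theorem mul_inv_cancel_left {g h : G} (hc : 𝒢.r g = 𝒢.r h) :
    𝒢.mul g (𝒢.mul (𝒢.inv g) h) = h := by
  rw [← 𝒢.mul_assoc _ _ _ (𝒢.r_inv g).symm (by rw [𝒢.s_inv, hc]), 𝒢.mul_inv, hc, 𝒢.unit_mul]

theorem mul_inv_cancel_right {g h : G} (hc : 𝒢.s g = 𝒢.r h) :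
    𝒢.mul (𝒢.mul g h) (𝒢.inv h) = g := by
  rw [𝒢.mul_assoc _ _ _ hc (𝒢.r_inv h).symm, 𝒢.mul_inv, ← hc, 𝒢.mul_unit]

theorem eq_inv_of_mul_eq_unit {g h : G} (hc : 𝒢.s g = 𝒢.r h) (h1 : 𝒢.mul g h = 𝒢.unit (𝒢.s h)) :
    g = 𝒢.inv h := by
  have := 𝒢.mul_inv_cancel_right hc
  rwa [h1, ← 𝒢.r_inv, 𝒢.unit_mul, eq_comm] at this

theorem eq_unit_of_mul_self {g : G} (hc : 𝒢.s g = 𝒢.r g) (h : 𝒢.mul g g = g) :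
    g = 𝒢.unit (𝒢.s g) := by
  have := 𝒢.inv_mul_cancel_left hc
  rwa [h, 𝒢.inv_mul, eq_comm] at this

section MinimalSection

variable {A : Type*} [Group A] (enc : A → ℕ) (α : G → A) (t : ℕ → X → G)

omit [MeasurableSpace X] [MeasurableSpace G] in
theorem exists_minimal_index (b : A) (x : X) :
    ∃ k, ∀ j, enc (b⁻¹ * α (t k x)) ≤ enc (b⁻¹ * α (t j x)) := by
  obtain ⟨_, ⟨k, rfl⟩, hk⟩ := WellFounded.has_min Nat.lt_wfRel.wf
    (Set.range fun k => enc (b⁻¹ * α (t k x))) (Set.range_nonempty _)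
  exact ⟨k, fun j => not_lt.1 (hk _ ⟨j, rfl⟩)⟩

open Classical in
/-- The first of the arrows `t k x` for which `b⁻¹ * α (t k x)` has the smallest code. -/
def minimalSection (b : A) (x : X) : G :=
  t (Nat.find (exists_minimal_index enc α t b x)) x

variable {𝒢 enc α t}

theorem r_minimalSection (ht : ∀ k x, 𝒢.r (t k x) = x) (b : A) (x : X) :
    𝒢.r (minimalSection enc α t b x) = x := ht _ x

omit [MeasurableSpace X] [MeasurableSpace G] in
theorem minimalSection_le (b : A) (x : X) (j : ℕ) :
    enc (b⁻¹ * α (minimalSection enc α t b x)) ≤ enc (b⁻¹ * α (t j x)) := by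
  classical
  exact Nat.find_spec (exists_minimal_index enc α t b x) j

theorem measurable_minimalSection [MeasurableSpace A] [Countable A] [DiscreteMeasurableSpace A]
    (hα : Measurable α) (ht : ∀ k, Measurable (t k)) (b : A) :
    Measurable (minimalSection enc α t b) := by
  classical
  have hK : Measurable fun x => Nat.find (exists_minimal_index enc α t b x) := by
    refine measurable_find _ fun k => ?_
    have hm : ∀ j, Measurable fun x => enc (b⁻¹ * α (t j x)) := fun j =>
      (Measurable.of_discrete (f := fun a : A => enc (b⁻¹ * a))).comp (hα.comp (ht j))
    simp only [Set.ofPred_forall]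
    exact MeasurableSet.iInter fun j => measurableSet_le (hm k) (hm j)
  exact (measurable_from_prod_countable_right (f := fun q : ℕ × X => t q.1 q.2) ht).comp
    (hK.prodMk measurable_id)

end MinimalSection

/-- An invariant set `X₀` over which the relations that define central subgroupoids, homomorphisms
and kernels hold without exception, and on which the maps `t k` enumerate the range fibres. -/
structure IsRegularOn {A C : Type*} [Group A] [Group C] (𝒮 : 𝒢.Subgroupoid) (ι : C × X → G)
    (α : G → A) (t : ℕ → X → G) (X₀ : Set X) : Prop where
  invariant : ∀ g, 𝒢.s g ∈ X₀ ↔ 𝒢.r g ∈ X₀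
  r_ι : ∀ x ∈ X₀, ∀ c, 𝒢.r (ι (c, x)) = x
  s_ι : ∀ x ∈ X₀, ∀ c, 𝒢.s (ι (c, x)) = x
  ι_mem : ∀ x ∈ X₀, ∀ c, ι (c, x) ∈ 𝒮.carrier
  ι_mul : ∀ x ∈ X₀, ∀ c d, ι (c * d, x) = 𝒢.mul (ι (c, x)) (ι (d, x))
  central : ∀ g, 𝒢.s g ∈ X₀ → ∀ c, 𝒢.mul g (ι (c, 𝒢.s g)) = 𝒢.mul (ι (c, 𝒢.r g)) g
  map_mul : ∀ g h, 𝒢.s g = 𝒢.r h → 𝒢.s h ∈ X₀ → α (𝒢.mul g h) = α g * α h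
  ker : ∀ g, 𝒢.s g ∈ X₀ → (α g = 1 ↔ g ∈ 𝒮.carrier)
  r_t : ∀ k x, 𝒢.r (t k x) = x
  exists_eq_t : ∀ g, 𝒢.s g ∈ X₀ → ∃ k, g = t k (𝒢.r g)

/-- The transport of `g` along the minimal sections. -/
def transport {A : Type*} [Group A] (τ : A → X → G) (α : G → A) (a : A) (g : G) : G :=
  𝒢.mul (𝒢.inv (τ (α g * a) (𝒢.r g))) (𝒢.mul g (τ a (𝒢.s g)))

theorem measurable_transport {A : Type*} [Group A] [Countable A] [MeasurableSpace A]
    [DiscreteMeasurableSpace A] {τ : A → X → G} {α : G → A} (hτ : ∀ b, Measurable (τ b))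
    (hα : Measurable α) (hr : ∀ b x, 𝒢.r (τ b x) = x) (a : A) :
    Measurable (𝒢.transport τ α a) := by
  have h1 : Measurable fun g => τ (α g * a) (𝒢.r g) :=
    (measurable_from_prod_countable_right (f := fun q : A × X => τ q.1 q.2) hτ).comp
      (((Measurable.of_discrete (f := fun b : A => b * a)).comp hα).prodMk 𝒢.measurable_r)
  exact 𝒢.measurable_mul_of_composable (𝒢.measurable_inv.comp h1)
    (𝒢.measurable_mul_of_composable measurable_id ((hτ a).comp 𝒢.measurable_s)
      fun g => (hr _ _).symm) fun g => by
        rw [𝒢.s_inv, hr, 𝒢.r_mul _ _ (hr _ _).symm]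

namespace IsRegularOn

variable {𝒢} {A C : Type*} [Group A] [Group C] {𝒮 : 𝒢.Subgroupoid} {ι : C × X → G}
  {α : G → A} {t : ℕ → X → G} {X₀ : Set X} (H : 𝒢.IsRegularOn 𝒮 ι α t X₀)

include H

theorem map_unit {x : X} (hx : x ∈ X₀) : α (𝒢.unit x) = 1 :=
  (H.ker _ (by rwa [𝒢.s_unit])).2 (𝒮.unit_mem x)

theorem map_inv {g : G} (hg : 𝒢.s g ∈ X₀) : α (𝒢.inv g) = (α g)⁻¹ := by
  have := H.map_mul (𝒢.inv g) g (𝒢.s_inv g) hg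
  rw [𝒢.inv_mul, H.map_unit hg] at this
  exact eq_inv_of_mul_eq_one_left this.symm

theorem ι_one {x : X} (hx : x ∈ X₀) : ι (1, x) = 𝒢.unit x := by
  have := 𝒢.eq_unit_of_mul_self (g := ι (1, x)) (by rw [H.r_ι x hx, H.s_ι x hx])
    (by rw [← H.ι_mul x hx, one_mul])
  rwa [H.s_ι x hx] at this

theorem α_ι {x : X} (hx : x ∈ X₀) (c : C) : α (ι (c, x)) = 1 :=
  (H.ker _ (by rwa [H.s_ι x hx])).2 (H.ι_mem x hx c)

theorem α_mul_ι {g : G} (hg : 𝒢.s g ∈ X₀) (c : C) : α (𝒢.mul g (ι (c, 𝒢.s g))) = α g := by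
  rw [H.map_mul _ _ (H.r_ι _ hg c).symm (by rwa [H.s_ι _ hg]), H.α_ι hg, mul_one]

theorem s_mul_ι {g : G} (hg : 𝒢.s g ∈ X₀) (c : C) : 𝒢.s (𝒢.mul g (ι (c, 𝒢.s g))) = 𝒢.s g := by
  rw [𝒢.s_mul _ _ (H.r_ι _ hg c).symm, H.s_ι _ hg]

theorem r_mul_ι {g : G} (hg : 𝒢.s g ∈ X₀) (c : C) : 𝒢.r (𝒢.mul g (ι (c, 𝒢.s g))) = 𝒢.r g := by
  rw [𝒢.r_mul _ _ (H.r_ι _ hg c).symm]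

theorem mul_mul_ι {g h : G} (hc : 𝒢.s g = 𝒢.r h) (hh : 𝒢.s h ∈ X₀) (c : C) :
    𝒢.mul (𝒢.mul g (ι (c, 𝒢.s g))) h = 𝒢.mul (𝒢.mul g h) (ι (c, 𝒢.s h)) := by
  have hrh : 𝒢.r h ∈ X₀ := (H.invariant h).1 hh
  rw [hc, 𝒢.mul_assoc _ _ _ (by rw [hc, H.r_ι _ hrh]) (H.s_ι _ hrh c), ← H.central h hh,
    𝒢.mul_assoc _ _ _ hc (by rw [H.r_ι _ hh])]

/-- On the regular set `ι` is multiplicative, so right multiplication by `ι (c, ·)` only translates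
the parameter of the coset. -/
theorem centralCoset_eq {g h : G} (hg : 𝒢.s g ∈ X₀) (h1 : h ∈ 𝒢.centralCoset ι g) :
    𝒢.centralCoset ι h = 𝒢.centralCoset ι g := by
  obtain ⟨c, rfl⟩ := h1
  have key : ∀ d, 𝒢.mul (𝒢.mul g (ι (c, 𝒢.s g))) (ι (d, 𝒢.s g)) =
      𝒢.mul g (ι (c * d, 𝒢.s g)) := by
    intro d
    rw [H.ι_mul _ hg, 𝒢.mul_assoc _ _ _ (by rw [H.r_ι _ hg]) (by rw [H.s_ι _ hg, H.r_ι _ hg])]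
  unfold centralCoset
  simp only [H.s_mul_ι hg]
  ext k
  constructor
  · rintro ⟨d, rfl⟩
    exact ⟨c * d, (key d).symm⟩
  · rintro ⟨d, rfl⟩
    exact ⟨c⁻¹ * d, by simp only [key, _root_.mul_inv_cancel_left]⟩

section

variable {enc : A → ℕ} (henc : Function.Injective enc)

include henc

/-- As `(α g * a)⁻¹ * α (g * h) = a⁻¹ * α h`, both minimisation problems range over the same set of
codes. The minimal codes agree, and injectivity of `enc` turns this into equality in `A`. The chosen
arrows themselves need not correspond under `g`; only their images under `α` do. -/
theorem α_minimalSection {g : G} (hg : 𝒢.s g ∈ X₀) (a : A) :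
    α (minimalSection enc α t (α g * a) (𝒢.r g)) = α g * α (minimalSection enc α t a (𝒢.s g)) := by
  set u := minimalSection enc α t (α g * a) (𝒢.r g) with hu
  set v := minimalSection enc α t a (𝒢.s g) with hv
  have hru : 𝒢.r u = 𝒢.r g := r_minimalSection H.r_t _ _
  have hrv : 𝒢.r v = 𝒢.s g := r_minimalSection H.r_t _ _
  have hsu : 𝒢.s u ∈ X₀ := by rwa [H.invariant, hru, ← H.invariant]
  have hsv : 𝒢.s v ∈ X₀ := by rwa [H.invariant, hrv]
  have hgv : α (𝒢.mul g v) = α g * α v := H.map_mul g v hrv.symm hsv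
  have hgu : α (𝒢.mul (𝒢.inv g) u) = (α g)⁻¹ * α u := by
    rw [H.map_mul _ _ (by rw [𝒢.s_inv, hru]) hsu, H.map_inv hg]
  obtain ⟨k, hk⟩ := H.exists_eq_t (𝒢.mul g v) (by rwa [𝒢.s_mul _ _ hrv.symm])
  obtain ⟨j, hj⟩ := H.exists_eq_t (𝒢.mul (𝒢.inv g) u)
    (by rwa [𝒢.s_mul _ _ (by rw [𝒢.s_inv, hru])])
  rw [𝒢.r_mul _ _ hrv.symm] at hk
  rw [𝒢.r_mul _ _ (by rw [𝒢.s_inv, hru]), 𝒢.r_inv] at hj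
  have h1 := minimalSection_le (enc := enc) (α := α) (t := t) (α g * a) (𝒢.r g) k
  have h2 := minimalSection_le (enc := enc) (α := α) (t := t) a (𝒢.s g) j
  rw [← hk, hgv, ← hu] at h1
  rw [← hj, hgu, ← hv] at h2
  have h3 : (α g * a)⁻¹ * (α g * α v) = a⁻¹ * α v := by group
  have h4 : (α g * a)⁻¹ * α u = a⁻¹ * ((α g)⁻¹ * α u) := by group
  rw [h3, h4] at h1
  have := henc (le_antisymm h1 h2)
  rw [mul_right_inj, inv_mul_eq_iff_eq_mul] at this
  exact this

end

section

variable {τ : A → X → G} (hr : ∀ b x, 𝒢.r (τ b x) = x)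

include hr

theorem s_τ_mem {x : X} (hx : x ∈ X₀) (b : A) : 𝒢.s (τ b x) ∈ X₀ := by
  rwa [H.invariant, hr]

omit H in
theorem s_transport (a : A) (g : G) : 𝒢.s (𝒢.transport τ α a g) = 𝒢.s (τ a (𝒢.s g)) := by
  rw [transport, 𝒢.s_mul _ _ (by rw [𝒢.s_inv, hr, 𝒢.r_mul _ _ (hr _ _).symm]),
    𝒢.s_mul _ _ (hr _ _).symm]

omit H in
theorem r_transport (a : A) (g : G) :
    𝒢.r (𝒢.transport τ α a g) = 𝒢.s (τ (α g * a) (𝒢.r g)) := by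
  rw [transport, 𝒢.r_mul _ _ (by rw [𝒢.s_inv, hr, 𝒢.r_mul _ _ (hr _ _).symm]), 𝒢.r_inv]

/-- The equivariance of `τ` is exactly what makes the three values of `α` cancel. -/
theorem transport_mem
    (hατ : ∀ g, 𝒢.s g ∈ X₀ → ∀ a, α (τ (α g * a) (𝒢.r g)) = α g * α (τ a (𝒢.s g)))
    {g : G} (hg : 𝒢.s g ∈ X₀) (a : A) : 𝒢.transport τ α a g ∈ 𝒮.carrier := by
  have hs : 𝒢.s (𝒢.mul g (τ a (𝒢.s g))) ∈ X₀ := by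
    rw [𝒢.s_mul _ _ (hr _ _).symm]
    exact H.s_τ_mem hr hg a
  rw [← H.ker _ (by rw [s_transport hr]; exact H.s_τ_mem hr hg a), transport,
    H.map_mul _ _ (by rw [𝒢.s_inv, hr, 𝒢.r_mul _ _ (hr _ _).symm]) hs,
    H.map_inv (H.s_τ_mem hr ((H.invariant g).1 hg) _), hατ g hg,
    H.map_mul _ _ (hr _ _).symm (H.s_τ_mem hr hg a), inv_mul_cancel]

/-- The cocycle identity: the two inner factors `τ (α h * a) (r h)` cancel. -/
theorem transport_mul {g h : G} (hc : 𝒢.s g = 𝒢.r h) (hh : 𝒢.s h ∈ X₀) (a : A) :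
    𝒢.transport τ α a (𝒢.mul g h) =
      𝒢.mul (𝒢.transport τ α (α h * a) g) (𝒢.transport τ α a h) := by
  have e1 : 𝒢.s h = 𝒢.r (τ a (𝒢.s h)) := (hr _ _).symm
  have e2 : 𝒢.s g = 𝒢.r (τ (α h * a) (𝒢.s g)) := (hr _ _).symm
  have e3 : 𝒢.s (𝒢.inv (τ (α g * (α h * a)) (𝒢.r g))) = 𝒢.r g := by rw [𝒢.s_inv, hr]
  have e4 : 𝒢.s (𝒢.inv (τ (α h * a) (𝒢.r h))) = 𝒢.r (𝒢.mul h (τ a (𝒢.s h))) := by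
    rw [𝒢.s_inv, hr, 𝒢.r_mul _ _ e1]
  unfold transport
  rw [H.map_mul _ _ hc hh, 𝒢.r_mul _ _ hc, 𝒢.s_mul _ _ hc, _root_.mul_assoc (α g),
    𝒢.mul_assoc g h _ hc e1,
    𝒢.mul_assoc _ _ _ (by rw [e3, 𝒢.r_mul _ _ e2])
      (by rw [𝒢.s_mul _ _ e2, 𝒢.r_mul _ _ e4, 𝒢.r_inv, hc]),
    𝒢.mul_assoc g (τ _ _) _ e2 (by rw [𝒢.r_mul _ _ e4, 𝒢.r_inv, hc]), hc,
    𝒢.mul_inv_cancel_left (by rw [hr, 𝒢.r_mul _ _ e1])]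

theorem transport_unit {x : X} (hx : x ∈ X₀) (a : A) :
    𝒢.transport τ α a (𝒢.unit x) = 𝒢.unit (𝒢.s (τ a x)) := by
  unfold transport
  rw [H.map_unit hx, one_mul, 𝒢.r_unit, 𝒢.s_unit]
  have := 𝒢.unit_mul (τ a x)
  rw [hr] at this
  rw [this, 𝒢.inv_mul]

theorem transport_inv {g : G} (hg : 𝒢.s g ∈ X₀) (a : A) :
    𝒢.transport τ α (α g * a) (𝒢.inv g) = 𝒢.inv (𝒢.transport τ α a g) := by
  refine 𝒢.eq_inv_of_mul_eq_unit ?_ ?_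
  · rw [s_transport hr, r_transport hr, 𝒢.s_inv]
  · rw [← H.transport_mul hr (𝒢.s_inv g) hg, 𝒢.inv_mul, H.transport_unit hr hg, s_transport hr]

/-- `a ↦ transport a` on `g⁻¹ h`, in terms of `g` and `h` separately. -/
theorem transport_inv_mul {g h : G} (hgh : 𝒢.r g = 𝒢.r h) (hh : 𝒢.s h ∈ X₀) (b : A) :
    𝒢.transport τ α ((α h)⁻¹ * b) (𝒢.mul (𝒢.inv g) h) =
      𝒢.mul (𝒢.inv (𝒢.transport τ α ((α g)⁻¹ * b) g)) (𝒢.transport τ α ((α h)⁻¹ * b) h) := by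
  have hg : 𝒢.s g ∈ X₀ := by rwa [H.invariant, hgh, ← H.invariant]
  rw [H.transport_mul hr (by rw [𝒢.s_inv, hgh]) hh, ← H.transport_inv hr hg]
  simp only [_root_.mul_inv_cancel_left]

theorem transport_mul_ι {g : G} (hg : 𝒢.s g ∈ X₀) (a : A) (c : C) :
    𝒢.transport τ α a (𝒢.mul g (ι (c, 𝒢.s g))) =
      𝒢.mul (𝒢.transport τ α a g) (ι (c, 𝒢.s (𝒢.transport τ α a g))) := by
  have hs := H.s_τ_mem hr hg a
  have e1 : 𝒢.s g = 𝒢.r (τ a (𝒢.s g)) := (hr _ _).symm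
  rw [s_transport hr]
  unfold transport
  rw [H.α_mul_ι hg, H.s_mul_ι hg, H.r_mul_ι hg, H.mul_mul_ι e1 hs]
  exact (𝒢.mul_assoc _ _ _ (by rw [𝒢.s_inv, hr, 𝒢.r_mul _ _ e1])
    (by rw [𝒢.s_mul _ _ e1, H.r_ι _ hs])).symm

end

end IsRegularOn

end DiscreteBorelGroupoid

/-! ### Passing to exact relations and to functions on all of the groupoid -/

namespace DiscreteBorelGroupoid

variable {X G C A : Type*} [MeasurableSpace X] [MeasurableSpace G]
  {𝒢 : DiscreteBorelGroupoid X G} {μ : Measure X} {𝒮 : 𝒢.Subgroupoid} {ι : C × X → G}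

theorem IsRegularOn.mono [Group A] [Group C] {α : G → A} {t : ℕ → X → G} {X₀ X₁ : Set X}
    (H : 𝒢.IsRegularOn 𝒮 ι α t X₀) (hs : X₁ ⊆ X₀) (hinv : ∀ g, 𝒢.s g ∈ X₁ ↔ 𝒢.r g ∈ X₁) :
    𝒢.IsRegularOn 𝒮 ι α t X₁ where
  invariant := hinv
  r_ι x hx := H.r_ι x (hs hx)
  s_ι x hx := H.s_ι x (hs hx)
  ι_mem x hx := H.ι_mem x (hs hx)
  ι_mul x hx := H.ι_mul x (hs hx)
  central g hg := H.central g (hs hg)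
  map_mul g h hc hh := H.map_mul g h hc (hs hh)
  ker g hg := H.ker g (hs hg)
  r_t := H.r_t
  exists_eq_t g hg := H.exists_eq_t g (hs hg)

variable [StandardBorelSpace X] [StandardBorelSpace G] [IsFiniteMeasure μ]

theorem IsRegularOn.exists_mono [Group A] [Group C] {α : G → A} {t : ℕ → X → G} {X₀ : Set X}
    (H : 𝒢.IsRegularOn 𝒮 ι α t X₀) (h𝒢 : 𝒢.IsQuasiInvariant μ) (hX₀ : ∀ᵐ x ∂μ, x ∈ X₀)
    {P : X → Prop} (hP : ∀ᵐ x ∂μ, P x) :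
    ∃ X₁ : Set X, (∀ᵐ x ∂μ, x ∈ X₁) ∧ (∀ x ∈ X₁, P x) ∧ 𝒢.IsRegularOn 𝒮 ι α t X₁ := by
  obtain ⟨X₁, h1, h2, h3⟩ := h𝒢.exists_invariant (hP.and hX₀)
  exact ⟨X₁, h1, fun x hx => (h2 x hx).1, H.mono (fun x hx => (h2 x hx).2) h3⟩

/-- Each relation holds on the full fibre over almost every unit. There are countably many of them,
and an invariant conull set inside the good units makes them all exact. -/
theorem exists_isRegularOn [Group C] [Countable C] [MeasurableSpace C] [DiscreteMeasurableSpace C]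
    [Group A] [Countable A] [MeasurableSpace A] [DiscreteMeasurableSpace A]
    (h𝒢 : 𝒢.IsQuasiInvariant μ) (hι : 𝒢.IsCentralSubgroupoid μ ι)
    (hι𝒮 : ∀ᵐ p ∂((trivialAction C X).arrowMeasure μ), ι p ∈ 𝒮.carrier)
    {α : G → A} (hα : 𝒢.IsHom μ (ofGroup A) (Measure.dirac ()) α)
    (hker : α ⁻¹' {1} =ᵐ[𝒢.arrowMeasure μ] 𝒮.carrier) :
    ∃ (α' : G → A) (t : ℕ → X → G) (X₀ : Set X), Measurable α' ∧ (∀ k, Measurable (t k)) ∧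
      (∀ᵐ x ∂μ, x ∈ X₀) ∧ 𝒢.IsRegularOn 𝒮 ι α' t X₀ := by
  obtain ⟨t, ht, hrt, hex⟩ := 𝒢.exists_enumeration μ
  have h1 := ae_arrowMeasure_iff.1 hα.aemeasurable.ae_eq_mk
  have h2 := ae_pairMeasure_iff.1 hα.map_mul
  have h3 := ae_arrowMeasure_iff.1 hker.mem_iff
  have h4 := ae_arrowMeasure_iff.1 hι.unit_space
  have h5 := ae_arrowMeasure_iff.1 hι𝒮
  have h6 := ae_pairMeasure_iff.1 hι.isHom.map_mul
  have h7 := ae_all_iff.2 fun c => ae_arrowMeasure_iff.1 (hι.central c)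
  obtain ⟨X₀, hX₀, hP, hinv⟩ := h𝒢.exists_invariant
    (((h1.and h2).and (h3.and h4)).and ((h5.and h6).and (h7.and hex)))
  have hP1 := fun x hx => (hP x hx).1.1.1
  have hP2 := fun x hx => (hP x hx).1.1.2
  have hP3 := fun x hx => (hP x hx).1.2.1
  have hP4 := fun x hx => (hP x hx).1.2.2
  have hP5 := fun x hx => (hP x hx).2.1.1
  have hP6 := fun x hx => (hP x hx).2.1.2
  have hP7 := fun x hx => (hP x hx).2.2.1
  have hP8 := fun x hx => (hP x hx).2.2.2
  -- Replacing `α` by a Borel representative is harmless, since the two agree on every arrow over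
  -- `X₀`.
  refine ⟨hα.aemeasurable.mk α, t, X₀, hα.aemeasurable.measurable_mk, ht, hX₀, ?_⟩
  exact {
    invariant := hinv
    r_ι := fun x hx c => (hP4 x hx (c, x) rfl).1
    s_ι := fun x hx c => (hP4 x hx (c, x) rfl).2
    ι_mem := fun x hx c => hP5 x hx (c, x) rfl
    ι_mul := fun x hx c d => (hP6 x hx (c, x) (d, x) rfl rfl).2
    central := fun g hg c => hP7 _ hg c g rfl
    map_mul := fun g h hc hh => by
      rw [← hP1 _ hh _ (𝒢.s_mul g h hc), ← hP1 _ hh h rfl,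
        ← hP1 _ ((hinv h).1 hh) g hc, (hP2 _ hh g h hc rfl).2]
      rfl
    ker := fun g hg => by
      rw [← hP1 _ hg g rfl]
      exact hP3 _ hg g rfl
    r_t := hrt
    exists_eq_t := fun g hg => hP8 _ ((hinv g).1 hg) g rfl }

/-- Functions on `𝒢`, of which only the restrictions to `𝒮` matter, that satisfy the conditions of
the generalized Haagerup property of `𝒮`, stated fibrewise over almost every unit. -/
structure IsGHAPFamilyOn [Group C] [TopologicalSpace C] (𝒢 : DiscreteBorelGroupoid X G)
    (μ : Measure X) (𝒮 : 𝒢.Subgroupoid) (ι : C × X → G) (V : ℕ → Set (PontryaginDual C))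
    (ψ : ℕ → PontryaginDual C → G → ℂ) : Prop where
  isCompact : ∀ n, IsCompact (V n)
  mem_nhds : ∀ n, V n ∈ 𝓝 1
  aemeasurable : ∀ n, ∀ χ ∈ V n, AEMeasurable (ψ n χ) (𝒢.arrowMeasure μ)
  nonneg : ∀ n, ∀ χ ∈ V n, ∀ᵐ x ∂μ, ∀ (m : ℕ) (g : Fin m → G) (lam : Fin m → ℂ),
    (∀ i, 𝒢.r (g i) = x) → (∀ i, g i ∈ 𝒮.carrier) →
      0 ≤ ∑ i, ∑ j, star (lam i) * lam j * ψ n χ (𝒢.mul (𝒢.inv (g i)) (g j))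
  map_unit : ∀ n, ∀ χ ∈ V n, ∀ᵐ x ∂μ, ψ n χ (𝒢.unit x) = 1
  tendsto : ∀ᵐ x ∂μ, ∀ g ∈ 𝒮.carrier, 𝒢.s g = x → ∀ ε : ℝ, 0 < ε →
    ∃ N : ℕ, ∀ n ≥ N, ∀ χ ∈ V n, ‖ψ n χ g - 1‖ < ε
  map_mul_ι : ∀ n, ∀ χ ∈ V n, ∀ᵐ x ∂μ, ∀ g ∈ 𝒮.carrier, 𝒢.s g = x → ∀ c : C,
    ψ n χ (𝒢.mul g (ι (c, 𝒢.s g))) = ψ n χ g * (χ c : ℂ)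
  continuousOn : ∀ n, ∀ᵐ x ∂μ, ∀ g ∈ 𝒮.carrier, 𝒢.s g = x →
    ContinuousOn (fun χ => ψ n χ g) (V n)
  c0 : ∀ n, ∀ χ ∈ V n, ∀ δ : ℝ, 0 < δ → ∀ ε : ℝ, 0 < ε → ∃ Y : Set X, NullMeasurableSet Y μ ∧
    μ Yᶜ < ENNReal.ofReal δ ∧ ∀ᵐ x ∂μ, x ∈ Y → ∃ Q : Set G, Q.Finite ∧
      ∀ g ∈ 𝒮.carrier, 𝒢.s g = x → 𝒢.r g ∈ Y → ε < ‖ψ n χ g‖ →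
        ∃ q ∈ Q, 𝒢.s q = x ∧ g ∈ 𝒢.centralCoset ι q

open Classical in
/-- Extension by zero of a function on a subgroupoid. -/
def Subgroupoid.extendZero (𝒮 : 𝒢.Subgroupoid) (φ : 𝒮.carrier → ℂ) (g : G) : ℂ :=
  if h : g ∈ 𝒮.carrier then φ ⟨g, h⟩ else 0

omit [StandardBorelSpace X] [StandardBorelSpace G] in
theorem Subgroupoid.extendZero_of_mem (φ : 𝒮.carrier → ℂ) {g : G} (h : g ∈ 𝒮.carrier) :
    𝒮.extendZero φ g = φ ⟨g, h⟩ := dif_pos h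

theorem Subgroupoid.aemeasurable_extendZero
    (h𝒮 : NullMeasurableSet 𝒮.carrier (𝒢.arrowMeasure μ)) {φ : 𝒮.carrier → ℂ}
    (hφ : AEMeasurable φ (𝒮.toGroupoid.arrowMeasure μ)) :
    AEMeasurable (𝒮.extendZero φ) (𝒢.arrowMeasure μ) := by
  classical
  obtain ⟨S, hS, hSm, hSe⟩ := h𝒮.exists_measurable_subset_ae_eq
  refine ⟨fun g => if h : g ∈ S then hφ.mk φ ⟨g, hS h⟩ else 0, ?_, ?_⟩
  · refine Measurable.dite (f := fun g : S => hφ.mk φ ⟨g, hS g.2⟩) (g := fun _ => 0)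
      (hφ.measurable_mk.comp ?_) measurable_const hSm
    exact measurable_subtype_coe.subtype_mk
  · rw [EventuallyEq, DiscreteBorelGroupoid.ae_arrowMeasure_iff]
    filter_upwards [(Subgroupoid.ae_arrowMeasure_iff h𝒮).1 hφ.ae_eq_mk,
      DiscreteBorelGroupoid.ae_arrowMeasure_iff.1 hSe.mem_iff] with x h1 h2 g hg
    by_cases h : g ∈ S
    · simp only [extendZero_of_mem φ (hS h), h, dif_pos]
      exact h1 ⟨g, hS h⟩ hg
    · simp only [h, dif_neg, not_false_eq_true]
      exact dif_neg fun h' => h ((h2 g hg).2 h')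

/-- Extension by zero gives functions that can be evaluated at transports without carrying proofs of
membership in `𝒮`. Finiteness modulo `C` is recast as a finite list of coset representatives, which
can be moved along arrows. -/
theorem Subgroupoid.exists_isGHAPFamilyOn [Group C] [Countable C] [TopologicalSpace C]
    [MeasurableSpace C] [DiscreteMeasurableSpace C]
    (h𝒮 : NullMeasurableSet 𝒮.carrier (𝒢.arrowMeasure μ))
    [Group A] {α : G → A} {t : ℕ → X → G} {X₀ : Set X} (hX₀ : ∀ᵐ x ∂μ, x ∈ X₀)
    (H : 𝒢.IsRegularOn 𝒮 ι α t X₀)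
    (h : 𝒮.toGroupoid.HasGHAP μ (𝒮.codRestrict ι)) :
    ∃ V ψ, 𝒢.IsGHAPFamilyOn μ 𝒮 ι V ψ := by
  obtain ⟨V, φ, hV, hpd, hlim, hmul, hcont, hc0⟩ := h
  have hcod : ∀ x ∈ X₀, ∀ c, (𝒮.codRestrict ι (c, x) : G) = ι (c, x) := by
    intro x hx c
    unfold Subgroupoid.codRestrict
    rw [dif_pos (H.ι_mem x hx c)]
  have hcm : ∀ (g : 𝒮.carrier), 𝒢.s g ∈ X₀ → ∀ c,
      (𝒮.mul g (𝒮.codRestrict ι (c, 𝒢.s g)) : G) = 𝒢.mul g (ι (c, 𝒢.s g)) := by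
    intro g hg c
    rw [𝒮.coe_mul _ _ (by rw [hcod _ hg, H.r_ι _ hg]), hcod _ hg]
  refine ⟨V, fun n χ => 𝒮.extendZero (φ n χ), ?_⟩
  constructor
  · exact fun n => (hV n).1
  · exact fun n => (hV n).2
  · exact fun n χ hχ => 𝒮.aemeasurable_extendZero h𝒮 (hpd n χ hχ).1.1
  · intro n χ hχ
    filter_upwards [(hpd n χ hχ).1.2] with x hx m g lam hg hgS
    convert hx m (fun i => ⟨g i, hgS i⟩) lam hg using 6 with i _ j _
    have hc : 𝒢.s (𝒢.inv (g i)) = 𝒢.r (g j) := by rw [𝒢.s_inv, hg, hg]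
    rw [𝒮.extendZero_of_mem _ (𝒮.mul_mem _ (𝒮.inv_mem _ (hgS i)) _ (hgS j) hc)]
    congr 1
    exact Subtype.ext (𝒮.coe_mul ⟨_, 𝒮.inv_mem _ (hgS i)⟩ ⟨_, hgS j⟩ hc).symm
  · intro n χ hχ
    filter_upwards [(hpd n χ hχ).2] with x hx
    rw [𝒮.extendZero_of_mem _ (𝒮.unit_mem x)]
    exact hx
  · filter_upwards [(Subgroupoid.ae_arrowMeasure_iff h𝒮).1 hlim] with x hx g hg hgx ε hε
    simpa only [𝒮.extendZero_of_mem _ hg] using hx ⟨g, hg⟩ hgx ε hε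
  · intro n χ hχ
    filter_upwards [(Subgroupoid.ae_arrowMeasure_iff h𝒮).1 (hmul n χ hχ), hX₀]
      with x hx hx₀ g hg hgx c
    have hgX : 𝒢.s g ∈ X₀ := hgx ▸ hx₀
    have := hx ⟨g, hg⟩ hgx c
    have hmem : 𝒢.mul g (ι (c, 𝒢.s g)) ∈ 𝒮.carrier :=
      𝒮.mul_mem _ hg _ (H.ι_mem _ hgX c) (H.r_ι _ hgX c).symm
    rw [𝒮.extendZero_of_mem _ hg, 𝒮.extendZero_of_mem _ hmem, ← this]
    congr 1
    exact Subtype.ext (hcm ⟨g, hg⟩ hgX c).symm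
  · intro n
    filter_upwards [(Subgroupoid.ae_arrowMeasure_iff h𝒮).1 (hcont n)] with x hx g hg hgx
    simpa only [𝒮.extendZero_of_mem _ hg] using hx ⟨g, hg⟩ hgx
  · intro n χ hχ δ hδ ε hε
    obtain ⟨Y, hY, hYδ, hfin⟩ := hc0 n χ hχ δ hδ ε hε
    refine ⟨Y, hY, hYδ, ?_⟩
    filter_upwards [hfin, hX₀] with x hx hx₀ hxY
    -- One arrow is chosen from the given set for each of the finitely many cosets.
    obtain ⟨T, hT, hTf, hTe⟩ := Set.Finite.exists_subset_finite_image_eq (hx hxY) subset_rfl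
    refine ⟨Subtype.val '' T, hTf.image _, fun g hg hgx hgY hgε => ?_⟩
    rw [𝒮.extendZero_of_mem _ hg] at hgε
    have hgX : 𝒢.s g ∈ X₀ := hgx ▸ hx₀
    have hmem := Set.mem_image_of_mem (𝒮.toGroupoid.centralCoset (𝒮.codRestrict ι))
      (show (⟨g, hg⟩ : 𝒮.carrier) ∈ {g | 𝒮.toGroupoid.s g = x ∧ 𝒮.toGroupoid.r g ∈ Y ∧
        ε < ‖φ n χ g‖} from ⟨hgx, hgY, hgε⟩)
    rw [← hTe] at hmem
    obtain ⟨q, hq, hqg⟩ := hmem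
    have hqx : 𝒢.s q = x := (hT hq).1
    have hself : (⟨g, hg⟩ : 𝒮.carrier) ∈
        𝒮.toGroupoid.centralCoset (𝒮.codRestrict ι) ⟨g, hg⟩ := by
      refine ⟨1, Subtype.ext ?_⟩
      exact (hcm ⟨g, hg⟩ hgX 1).trans (by rw [H.ι_one hgX, 𝒢.mul_unit])
    rw [← hqg] at hself
    obtain ⟨c, hc⟩ := hself
    refine ⟨q, ⟨q, hq, rfl⟩, hqx, c, ?_⟩
    have := congrArg Subtype.val hc
    exact (hcm q (hqx ▸ hx₀) c).symm.trans this

end DiscreteBorelGroupoid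

/-! ### Diagonal sequences and nonsingular maps -/

section

variable {Ω : Type*} [MeasurableSpace Ω] {μ : Measure Ω} [IsFiniteMeasure μ]

theorem tendsto_measure_zero_of_ae_eventually_notMem {B : ℕ → Set Ω}
    (hB : ∀ i, NullMeasurableSet (B i) μ) (h : ∀ᵐ ω ∂μ, ∀ᶠ i in atTop, ω ∉ B i) :
    Tendsto (fun i => μ (B i)) atTop (𝓝 0) := by
  have hanti : Antitone fun n => ⋃ i ≥ n, B i := fun n m hnm =>
    Set.biUnion_subset_biUnion_left fun i (hi : m ≤ i) => le_trans hnm hi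
  have hmeas : ∀ n, NullMeasurableSet (⋃ i ≥ n, B i) μ := fun n =>
    NullMeasurableSet.iUnion fun i => NullMeasurableSet.iUnion fun _ => hB i
  have h1 := tendsto_measure_iInter_atTop hmeas hanti ⟨0, measure_ne_top _ _⟩
  have h0 : μ (⋂ n, ⋃ i ≥ n, B i) = 0 := by
    refine measure_mono_null (fun ω hω => ?_) h
    intro hev
    obtain ⟨n, hn⟩ := eventually_atTop.1 hev
    obtain ⟨i, hi, hmem⟩ := Set.mem_iUnion₂.1 (Set.mem_iInter.1 hω n)
    exact hn i hi hmem
  rw [h0] at h1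
  exact tendsto_of_tendsto_of_tendsto_of_le_of_le tendsto_const_nhds h1 (fun _ => zero_le)
    fun n => measure_mono fun ω hω => Set.mem_iUnion₂.2 ⟨n, le_rfl, hω⟩

/-- A diagonal sequence along which almost every point eventually avoids the exceptional sets. -/
theorem exists_diagonal_ae_eventually_notMem {B : ℕ → ℕ → Set Ω}
    (hB : ∀ k m, NullMeasurableSet (B k m) μ) (h : ∀ k, ∀ᵐ ω ∂μ, ∀ᶠ m in atTop, ω ∉ B k m) :
    ∃ m : ℕ → ℕ, ∀ᵐ ω ∂μ, ∀ᶠ k in atTop, ω ∉ B k (m k) := by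
  -- A summable bound, as the Borel–Cantelli lemma requires.
  have h1 : ∀ k : ℕ, ∃ m, μ (B k m) < (2⁻¹ : ENNReal) ^ k := fun k =>
    ((tendsto_measure_zero_of_ae_eventually_notMem (hB k) (h k)).eventually_lt_const
      (ENNReal.pow_pos (by simp) k)).exists
  choose m hm using h1
  refine ⟨m, ae_eventually_notMem
    (ne_top_of_le_ne_top ?_ (ENNReal.tsum_le_tsum fun k => (hm k).le))⟩
  rw [ENNReal.tsum_geometric]
  simp

end

theorem quasiMeasurePreserving_of_ae {Y Z : Type*} [MeasurableSpace Y] [MeasurableSpace Z]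
    {μ : Measure Y} {ν : Measure Z} {f : Y → Z} (hf : Measurable f)
    (h : ∀ P : Z → Prop, (∀ᵐ z ∂ν, P z) → ∀ᵐ y ∂μ, P (f y)) :
    Measure.QuasiMeasurePreserving f μ ν :=
  ⟨hf, Measure.AbsolutelyContinuous.mk fun s hs h0 => by
    rw [Measure.map_apply hf hs]
    exact measure_eq_zero_iff_ae_notMem.2 (h _ (measure_eq_zero_iff_ae_notMem.1 h0))⟩

theorem PontryaginDual.secondCountableTopology (C : Type*) [Group C] [Countable C]
    [TopologicalSpace C] [DiscreteTopology C] : SecondCountableTopology (PontryaginDual C) :=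
  (ContinuousMonoidHom.isInducing_toContinuousMap C Circle).secondCountableTopology

theorem exists_countable_subset_closure_eq {Z : Type*} [TopologicalSpace Z] [T2Space Z]
    [SecondCountableTopology Z] {K : Set Z} (hK : IsCompact K) :
    ∃ D ⊆ K, D.Countable ∧ closure D = K := by
  obtain ⟨s, hs, hd⟩ := TopologicalSpace.exists_countable_dense K
  refine ⟨Subtype.val '' s, by simp, hs.image _, Set.Subset.antisymm
    (closure_minimal (by simp) hK.isClosed) fun z hz => ?_⟩
  exact (closure_subtype (x := (⟨z, hz⟩ : K))).1 (hd ⟨z, hz⟩)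

/-! ### Følner averages: measurability, normalization, equivariance, positivity -/

namespace DiscreteBorelGroupoid

variable {X G C A : Type*} [MeasurableSpace X] [MeasurableSpace G]
  {𝒢 : DiscreteBorelGroupoid X G} {μ : Measure X} {𝒮 : 𝒢.Subgroupoid} {ι : C × X → G}

open Classical in
/-- The average over `F` of the transported functions. -/
def folnerAverage (𝒢 : DiscreteBorelGroupoid X G) [Group A] (τ : A → X → G) (α : G → A)
    (F : Finset A) (ψ : G → ℂ) (g : G) : ℂ :=
  (F.card : ℂ)⁻¹ * ∑ a ∈ F, if α g * a ∈ F then ψ (𝒢.transport τ α a g) else 0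

section QuasiPreserving

variable [StandardBorelSpace X] [StandardBorelSpace G] [IsFiniteMeasure μ]

theorem IsQuasiInvariant.quasiMeasurePreserving_s_comp (h𝒢 : 𝒢.IsQuasiInvariant μ) {τ : X → G}
    (hτ : Measurable τ) (hr : ∀ x, 𝒢.r (τ x) = x) :
    Measure.QuasiMeasurePreserving (fun x => 𝒢.s (τ x)) μ μ := by
  refine quasiMeasurePreserving_of_ae (𝒢.measurable_s.comp hτ) fun P hP => ?_
  filter_upwards [h𝒢.ae_orbit hP] with x hx
  rw [← 𝒢.r_inv]
  exact hx _ (by rw [𝒢.s_inv, hr])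

theorem quasiMeasurePreserving_inv_comp {τ : X → G}
    (hτ : Measurable τ) (hr : ∀ x, 𝒢.r (τ x) = x) :
    Measure.QuasiMeasurePreserving (fun x => 𝒢.inv (τ x)) μ (𝒢.arrowMeasure μ) := by
  refine quasiMeasurePreserving_of_ae (𝒢.measurable_inv.comp hτ) fun P hP => ?_
  filter_upwards [ae_arrowMeasure_iff.1 hP] with x hx
  exact hx _ (by rw [𝒢.s_inv, hr])

/-- A conull set of arrows contains the whole source fibre over almost every unit. The source of a
transport is `s (τ a (s g))`, and `x ↦ s (τ a x)` is nonsingular because it moves points inside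
their orbits. -/
theorem IsQuasiInvariant.quasiMeasurePreserving_transport [Group A] [Countable A]
    [MeasurableSpace A] [DiscreteMeasurableSpace A] (h𝒢 : 𝒢.IsQuasiInvariant μ) {τ : A → X → G}
    {α : G → A} (hτ : ∀ b, Measurable (τ b)) (hα : Measurable α) (hr : ∀ b x, 𝒢.r (τ b x) = x)
    (a : A) : Measure.QuasiMeasurePreserving (𝒢.transport τ α a) (𝒢.arrowMeasure μ)
      (𝒢.arrowMeasure μ) := by
  refine quasiMeasurePreserving_of_ae (𝒢.measurable_transport hτ hα hr a) fun P hP => ?_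
  rw [ae_arrowMeasure_iff] at hP ⊢
  filter_upwards [(h𝒢.quasiMeasurePreserving_s_comp (hτ a) (hr a)).ae hP] with x hx g hg
  exact hx _ (by rw [IsRegularOn.s_transport hr, hg])

theorem IsQuasiInvariant.aemeasurable_folnerAverage [Group A] [Countable A]
    [MeasurableSpace A] [DiscreteMeasurableSpace A] (h𝒢 : 𝒢.IsQuasiInvariant μ) {τ : A → X → G}
    {α : G → A} (hτ : ∀ b, Measurable (τ b)) (hα : Measurable α) (hr : ∀ b x, 𝒢.r (τ b x) = x)
    (F : Finset A) {ψ : G → ℂ} (hψ : AEMeasurable ψ (𝒢.arrowMeasure μ)) :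
    AEMeasurable (𝒢.folnerAverage τ α F ψ) (𝒢.arrowMeasure μ) := by
  classical
  refine AEMeasurable.const_mul (Finset.aemeasurable_fun_sum F fun a _ => ?_) _
  have h1 : Measurable fun g => if α g * a ∈ F then (1 : ℂ) else 0 :=
    (Measurable.of_discrete (f := fun b : A => if b * a ∈ F then (1 : ℂ) else 0)).comp hα
  have h2 := hψ.comp_quasiMeasurePreserving (h𝒢.quasiMeasurePreserving_transport hτ hα hr a)
  convert h1.aemeasurable.mul h2 using 1
  ext g
  simp

end QuasiPreserving

section Average

variable [Group A] {α : G → A} {τ : A → X → G} {F : Finset A} {ψ : G → ℂ}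

/-- If all terms of a mean are at most `ε` in norm, then so is the mean. -/
theorem exists_lt_norm_of_lt_norm_folnerAverage (hF : F.Nonempty) {g : G} {ε : ℝ} (hε : 0 < ε)
    (h : ε < ‖𝒢.folnerAverage τ α F ψ g‖) :
    ∃ a ∈ F, α g * a ∈ F ∧ ε < ‖ψ (𝒢.transport τ α a g)‖ := by
  classical
  by_contra! hcon
  have hcard : (0 : ℝ) < F.card := by exact_mod_cast hF.card_pos
  have h1 : ‖∑ a ∈ F, if α g * a ∈ F then ψ (𝒢.transport τ α a g) else 0‖ ≤ F.card * ε := by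
    rw [← nsmul_eq_mul]
    refine (norm_sum_le _ _).trans (Finset.sum_le_card_nsmul F _ _ fun a ha => ?_)
    split_ifs with hc
    · exact hcon a ha hc
    · simpa using hε.le
  rw [folnerAverage, norm_mul, norm_inv, Complex.norm_natCast] at h
  have h2 := h.trans_le (mul_le_mul_of_nonneg_left h1 (inv_nonneg.2 hcard.le))
  rw [← _root_.mul_assoc, inv_mul_cancel₀ hcard.ne', one_mul] at h2
  exact lt_irrefl _ h2

theorem norm_folnerAverage_sub_one_le (hF : F.Nonempty) {g : G} {ε : ℝ} (hε : 0 ≤ ε)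
    (h : ∀ a ∈ F, ‖ψ (𝒢.transport τ α a g) - 1‖ ≤ ε) :
    ‖𝒢.folnerAverage τ α F ψ g - 1‖ ≤ ε +
      ((symmDiff (α g • (F : Set A)) (F : Set A)).ncard : ℝ) / (F.card : ℝ) := by
  classical
  have hcard : (0 : ℝ) < F.card := by exact_mod_cast hF.card_pos
  have hcard' : (F.card : ℂ) ≠ 0 := by exact_mod_cast hF.card_ne_zero
  have h1 : 𝒢.folnerAverage τ α F ψ g - 1 = (F.card : ℂ)⁻¹ *
      ∑ a ∈ F, ((if α g * a ∈ F then ψ (𝒢.transport τ α a g) else 0) - 1) := by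
    rw [Finset.sum_sub_distrib, Finset.sum_const, nsmul_eq_mul, mul_one, mul_sub,
      inv_mul_cancel₀ hcard', folnerAverage]
  have h2 : ∀ a ∈ F, ‖(if α g * a ∈ F then ψ (𝒢.transport τ α a g) else 0) - 1‖ ≤
      ε + if α g * a ∈ F then 0 else 1 := by
    intro a ha
    split_ifs
    · simpa using h a ha
    · simpa using hε
  have h3 : ((F.filter fun a => α g * a ∉ F).card : ℝ) ≤
      ((symmDiff (α g • (F : Set A)) (F : Set A)).ncard : ℝ) := by
    have hfin : (symmDiff (α g • (F : Set A)) (F : Set A)).Finite :=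
      (F.finite_toSet.smul_set).symmDiff F.finite_toSet
    -- Left multiplication by `α g` carries the lost indices injectively into `α g • F` minus `F`.
    rw [← Finset.card_image_of_injective _ (mul_right_injective (α g)), ← Set.ncard_coe_finset]
    refine Nat.cast_le.2 (Set.ncard_le_ncard (fun b hb => ?_) hfin)
    obtain ⟨a, ha, rfl⟩ := Finset.mem_image.1 (Finset.mem_coe.1 hb)
    exact Or.inl ⟨⟨a, (Finset.mem_filter.1 ha).1, rfl⟩, (Finset.mem_filter.1 ha).2⟩
  rw [h1, norm_mul, norm_inv, Complex.norm_natCast]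
  calc (F.card : ℝ)⁻¹ * ‖∑ a ∈ F, ((if α g * a ∈ F then ψ (𝒢.transport τ α a g) else 0) - 1)‖
      ≤ (F.card : ℝ)⁻¹ * ∑ a ∈ F, (ε + if α g * a ∈ F then 0 else 1) := by
        gcongr
        exact norm_sum_le_of_le _ h2
    _ = ε + ((F.filter fun a => α g * a ∉ F).card : ℝ) / F.card := by
        rw [Finset.sum_add_distrib, Finset.sum_const, nsmul_eq_mul, Finset.card_filter,
          Nat.cast_sum]
        simp only [Nat.cast_ite, Nat.cast_one, Nat.cast_zero, ite_not]
        field_simp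
    _ ≤ _ := by gcongr

theorem continuousOn_folnerAverage {Z : Type*} [TopologicalSpace Z] {V : Set Z} {ψ : Z → G → ℂ}
    {g : G} (h : ∀ a ∈ F, ContinuousOn (fun χ => ψ χ (𝒢.transport τ α a g)) V) :
    ContinuousOn (fun χ => 𝒢.folnerAverage τ α F (ψ χ) g) V := by
  classical
  refine continuousOn_const.mul (continuousOn_finsetSum F fun a ha => ?_)
  by_cases hc : α g * a ∈ F
  · simpa only [if_pos hc] using h a ha
  · simpa only [if_neg hc] using continuousOn_const

variable [Group C] {t : ℕ → X → G} {X₀ : Set X} (H : 𝒢.IsRegularOn 𝒮 ι α t X₀)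
  (hr : ∀ b x, 𝒢.r (τ b x) = x)

include H hr

theorem IsRegularOn.folnerAverage_unit (hF : F.Nonempty)
    (hψ : ∀ x ∈ X₀, ψ (𝒢.unit x) = 1) {x : X} (hx : x ∈ X₀) :
    𝒢.folnerAverage τ α F ψ (𝒢.unit x) = 1 := by
  classical
  have : ∀ a ∈ F, (if α (𝒢.unit x) * a ∈ F then ψ (𝒢.transport τ α a (𝒢.unit x)) else 0) = 1 := by
    intro a ha
    rw [H.map_unit hx, one_mul, if_pos ha, H.transport_unit hr hx, hψ _ (H.s_τ_mem hr hx a)]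
  rw [folnerAverage, Finset.sum_congr rfl this, Finset.sum_const, nsmul_eq_mul, mul_one,
    inv_mul_cancel₀]
  exact_mod_cast hF.card_ne_zero

theorem IsRegularOn.folnerAverage_mul_ι
    (hατ : ∀ g, 𝒢.s g ∈ X₀ → ∀ a, α (τ (α g * a) (𝒢.r g)) = α g * α (τ a (𝒢.s g)))
    {c : C} {z : ℂ} (hψ : ∀ g ∈ 𝒮.carrier, 𝒢.s g ∈ X₀ → ψ (𝒢.mul g (ι (c, 𝒢.s g))) = ψ g * z)
    {g : G} (hg : 𝒢.s g ∈ X₀) :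
    𝒢.folnerAverage τ α F ψ (𝒢.mul g (ι (c, 𝒢.s g))) = 𝒢.folnerAverage τ α F ψ g * z := by
  classical
  rw [folnerAverage, folnerAverage, _root_.mul_assoc, Finset.sum_mul]
  congr 1
  refine Finset.sum_congr rfl fun a _ => ?_
  rw [H.α_mul_ι hg, H.transport_mul_ι hr hg, hψ _ (H.transport_mem hr hατ hg a)
    (by rw [s_transport hr]; exact H.s_τ_mem hr hg a), ite_mul, zero_mul]

/-- With `b = α (g j) * a`, the transport of `(g i)⁻¹ * g j` factors as `(k b i)⁻¹ * k b j`, and the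
two conditions defining the average become `(α (g i))⁻¹ * b ∈ F` and `(α (g j))⁻¹ * b ∈ F`. These
are absorbed into the coefficients, leaving for each `b` a positive sum for `ψ` over the unit `s (τ
b x)`. -/
theorem IsRegularOn.folnerAverage_nonneg
    (hατ : ∀ g, 𝒢.s g ∈ X₀ → ∀ a, α (τ (α g * a) (𝒢.r g)) = α g * α (τ a (𝒢.s g)))
    (hψ : ∀ x ∈ X₀, ∀ (m : ℕ) (g : Fin m → G) (lam : Fin m → ℂ),
      (∀ i, 𝒢.r (g i) = x) → (∀ i, g i ∈ 𝒮.carrier) →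
        0 ≤ ∑ i, ∑ j, star (lam i) * lam j * ψ (𝒢.mul (𝒢.inv (g i)) (g j)))
    {x : X} (hx : x ∈ X₀) (m : ℕ) (g : Fin m → G) (lam : Fin m → ℂ) (hg : ∀ i, 𝒢.r (g i) = x) :
    0 ≤ ∑ i, ∑ j, star (lam i) * lam j *
      𝒢.folnerAverage τ α F ψ (𝒢.mul (𝒢.inv (g i)) (g j)) := by
  classical
  have hgX : ∀ i, 𝒢.s (g i) ∈ X₀ := fun i => by rwa [H.invariant, hg]
  -- A finite range for `b` that serves all `j` at once; the extra `b` have vanishing coefficient.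
  let B : Finset A := Finset.univ.biUnion fun i => F.image fun a => α (g i) * a
  let k : A → Fin m → G := fun b i => 𝒢.transport τ α ((α (g i))⁻¹ * b) (g i)
  let l : A → Fin m → ℂ := fun b i => if (α (g i))⁻¹ * b ∈ F then lam i else 0
  have hk : ∀ b, 0 ≤ ∑ i, ∑ j, star (l b i) * l b j * ψ (𝒢.mul (𝒢.inv (k b i)) (k b j)) := by
    intro b
    refine hψ (𝒢.s (τ b x)) (H.s_τ_mem hr hx b) m (k b) (l b) (fun i => ?_) fun i =>
      H.transport_mem hr hατ (hgX i) _
    rw [r_transport hr, hg, _root_.mul_inv_cancel_left]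
  have hij : ∀ i j, star (lam i) * lam j *
      𝒢.folnerAverage τ α F ψ (𝒢.mul (𝒢.inv (g i)) (g j)) =
      (F.card : ℂ)⁻¹ * ∑ b ∈ B, star (l b i) * l b j * ψ (𝒢.mul (𝒢.inv (k b i)) (k b j)) := by
    intro i j
    rw [folnerAverage, mul_left_comm, Finset.mul_sum]
    congr 1
    have hαij : α (𝒢.mul (𝒢.inv (g i)) (g j)) = (α (g i))⁻¹ * α (g j) := by
      rw [H.map_mul _ _ (by rw [𝒢.s_inv, hg, hg]) (hgX j), H.map_inv (hgX i)]
    have himg : F.image (fun a => α (g j) * a) ⊆ B := fun b hb =>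
      Finset.mem_biUnion.2 ⟨j, Finset.mem_univ j, hb⟩
    rw [← Finset.sum_subset himg, Finset.sum_image fun a _ b _ h => mul_left_cancel h]
    · refine Finset.sum_congr rfl fun a ha => ?_
      have htr := H.transport_inv_mul hr (g := g i) (h := g j) (by rw [hg, hg]) (hgX j)
        (α (g j) * a)
      simp only [k, l]
      rw [← htr, _root_.inv_mul_cancel_left, if_pos ha, hαij, _root_.mul_assoc (α (g i))⁻¹]
      split_ifs <;> simp
    · intro b _ hb
      have : l b j = 0 := by
        simp only [l]
        refine if_neg fun h => hb (Finset.mem_image.2 ⟨_, h, by simp⟩)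
      rw [this]
      simp
  simp_rw [hij, ← Finset.mul_sum]
  refine mul_nonneg (by simp) ?_
  have : ∑ i, ∑ j, ∑ b ∈ B, star (l b i) * l b j * ψ (𝒢.mul (𝒢.inv (k b i)) (k b j)) =
      ∑ b ∈ B, ∑ i, ∑ j, star (l b i) * l b j * ψ (𝒢.mul (𝒢.inv (k b i)) (k b j)) := by
    rw [Finset.sum_comm (s := B)]
    exact Finset.sum_congr rfl fun i _ => Finset.sum_comm
  rw [this]
  exact Finset.sum_nonneg fun b _ => hk b

end Average

end DiscreteBorelGroupoid

/-! ### Decay modulo the centre, and the diagonal choice of indices -/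

namespace DiscreteBorelGroupoid

variable {X G C A : Type*} [MeasurableSpace X] [StandardBorelSpace X] [MeasurableSpace G]
  [StandardBorelSpace G] {𝒢 : DiscreteBorelGroupoid X G} {μ : Measure X} [IsFiniteMeasure μ]
  {𝒮 : 𝒢.Subgroupoid} {ι : C × X → G} [Group C] [Group A] [Countable A] {α : G → A}
  {t : ℕ → X → G} {X₀ : Set X} {τ : A → X → G}

/-- A large value at `g` gives `a ∈ F` with `ψ` large at the transport, which is then a
representative `q` from a finite list, modulo `C`. Now `g` is recovered as `τ (α g * a) (r g) * q *
(τ a x)⁻¹` modulo `C`. The first factor depends on the unknown `r g`, but off a small set it is one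
of finitely many arrows with source `r q`. -/
theorem IsRegularOn.isC0ModCentral_folnerAverage (H : 𝒢.IsRegularOn 𝒮 ι α t X₀)
    (h𝒢 : 𝒢.IsQuasiInvariant μ) (hX₀ : ∀ᵐ x ∂μ, x ∈ X₀) (ht : ∀ k, Measurable (t k))
    (hτ : ∀ b, Measurable (τ b)) (hr : ∀ b x, 𝒢.r (τ b x) = x)
    (hατ : ∀ g, 𝒢.s g ∈ X₀ → ∀ a, α (τ (α g * a) (𝒢.r g)) = α g * α (τ a (𝒢.s g)))
    {F : Finset A} (hF : F.Nonempty) {ψ : G → ℂ}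
    (hψ : ∀ δ : ℝ, 0 < δ → ∀ ε : ℝ, 0 < ε → ∃ Y : Set X, NullMeasurableSet Y μ ∧
      μ Yᶜ < ENNReal.ofReal δ ∧ ∀ᵐ x ∂μ, x ∈ Y → ∃ Q : Set G, Q.Finite ∧
        ∀ g ∈ 𝒮.carrier, 𝒢.s g = x → 𝒢.r g ∈ Y → ε < ‖ψ g‖ →
          ∃ q ∈ Q, 𝒢.s q = x ∧ g ∈ 𝒢.centralCoset ι q) :
    𝒢.IsC0ModCentral μ ι (𝒢.folnerAverage τ α F ψ) := by
  intro δ hδ ε hε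
  -- Summable exceptional measures, so that almost every point, and by nonsingularity almost every
  -- `s (τ a x)`, lies in `Y i` for all large `i`.
  choose Y hYm hYμ hYfin using fun i : ℕ => hψ ((2⁻¹ : ℝ) ^ i) (by positivity) ε hε
  have hYev : ∀ᵐ x ∂μ, ∀ᶠ i in atTop, x ∉ (Y i)ᶜ := by
    refine ae_eventually_notMem
      (ne_top_of_le_ne_top ?_ (ENNReal.tsum_le_tsum fun i => (hYμ i).le))
    simp_rw [ENNReal.ofReal_pow (show (0 : ℝ) ≤ 2⁻¹ by norm_num)]
    rw [ENNReal.tsum_geometric, ENNReal.ofReal_inv_of_pos two_pos]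
    simp
  have hqmp := fun a => h𝒢.quasiMeasurePreserving_s_comp (hτ a) (hr a)
  -- The points at which `τ a x` is not yet among the first `i + 1` enumerated arrows out of its
  -- source. These sets shrink to a null set as `i` grows.
  let N : A → ℕ → Set X := fun a i => {x | ∀ k ≤ i, τ a x ≠ 𝒢.inv (t k (𝒢.s (τ a x)))}
  have hNm : ∀ a i, MeasurableSet (N a i) := by
    intro a i
    have : N a i = ⋂ k ∈ Set.Iic i, {x | τ a x = 𝒢.inv (t k (𝒢.s (τ a x)))}ᶜ := by
      ext x
      simp [N]
    rw [this]
    exact MeasurableSet.biInter (Set.to_countable _) fun k _ => (measurableSet_eq_fun (hτ a)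
      (𝒢.measurable_inv.comp ((ht k).comp (𝒢.measurable_s.comp (hτ a))))).compl
  let B : ℕ → Set X := fun i => ⋃ a ∈ F, ((fun x => 𝒢.s (τ a x)) ⁻¹' (Y i)ᶜ ∪ N a i)
  have hBm : ∀ i, NullMeasurableSet (B i) μ := fun i =>
    NullMeasurableSet.iUnion fun a => NullMeasurableSet.iUnion fun _ =>
      ((hYm i).compl.preimage (hqmp a)).union (hNm a i).nullMeasurableSet
  have hBev : ∀ᵐ x ∂μ, ∀ᶠ i in atTop, x ∉ B i := by
    filter_upwards [ae_all_iff.2 fun a => (hqmp a).ae hYev, hX₀] with x hx hx₀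
    have : ∀ a ∈ F, ∀ᶠ i in atTop, x ∉ (fun x => 𝒢.s (τ a x)) ⁻¹' (Y i)ᶜ ∪ N a i := by
      intro a _
      obtain ⟨k, hk⟩ := H.exists_eq_t (𝒢.inv (τ a x)) (by rwa [𝒢.s_inv, hr])
      filter_upwards [hx a, eventually_ge_atTop k] with i hi hki
      rintro (h | h)
      · exact hi h
      · refine h k hki ?_
        rw [𝒢.r_inv] at hk
        rw [← hk, 𝒢.inv_inv]
    filter_upwards [(eventually_all_finset F).2 this] with i hi hmem
    obtain ⟨a, ha, h⟩ := Set.mem_iUnion₂.1 hmem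
    exact hi a ha h
  obtain ⟨i, hi⟩ := ((tendsto_measure_zero_of_ae_eventually_notMem hBm hBev).eventually_lt_const
    (ENNReal.ofReal_pos.2 hδ)).exists
  refine ⟨(B i)ᶜ, (hBm i).compl, by rwa [compl_compl], ?_⟩
  have hnot : ∀ x ∉ B i, ∀ a ∈ F, 𝒢.s (τ a x) ∈ Y i ∧
      ∃ k ≤ i, τ a x = 𝒢.inv (t k (𝒢.s (τ a x))) := by
    intro x hx a ha
    have h1 : x ∉ (fun x => 𝒢.s (τ a x)) ⁻¹' (Y i)ᶜ ∪ N a i := fun h =>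
      hx (Set.mem_iUnion₂.2 ⟨a, ha, h⟩)
    simp only [Set.mem_union, not_or, N, Set.mem_preimage, Set.mem_compl_iff, not_not,
      Set.mem_ofPred_eq, not_forall, exists_prop, ne_eq] at h1
    exact h1
  filter_upwards [ae_all_iff.2 fun a => (hqmp a).ae (hYfin i), hX₀] with x hx hx₀ hxB
  choose! Q hQf hQ using fun (a : A) (ha : a ∈ F) => hx a (hnot x hxB a ha).1
  refine Set.Finite.subset (s := ⋃ a ∈ F, ⋃ k ∈ Set.Iic i, (fun q => 𝒢.centralCoset ι
    (𝒢.mul (𝒢.mul (𝒢.inv (t k (𝒢.r q))) q) (𝒢.inv (τ a x)))) '' Q a)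
    (F.finite_toSet.biUnion fun a ha => (Set.finite_Iic i).biUnion fun k _ =>
      (hQf a ha).image _) ?_
  rintro _ ⟨g, ⟨hgx, hgB, hgε⟩, rfl⟩
  obtain ⟨a, ha, hb, hε'⟩ := exists_lt_norm_of_lt_norm_folnerAverage hF hε hgε
  have hgX : 𝒢.s g ∈ X₀ := hgx ▸ hx₀
  obtain ⟨hbY, k, hk, hbk⟩ := hnot _ hgB _ hb
  obtain ⟨q, hq, hqs, c, hc⟩ := hQ a ha _ (H.transport_mem hr hατ hgX a)
    (by rw [s_transport hr, hgx]) (by rwa [r_transport hr]) hε'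
  have hsτ : 𝒢.s (τ a x) ∈ X₀ := H.s_τ_mem hr hx₀ a
  have hqX : 𝒢.s q ∈ X₀ := hqs ▸ hsτ
  simp only at hc
  have hrq : 𝒢.r q = 𝒢.s (τ (α g * a) (𝒢.r g)) := by
    rw [← r_transport hr, ← hc, H.r_mul_ι hqX]
  rw [← hrq] at hbk
  refine Set.mem_iUnion₂.2 ⟨a, ha, Set.mem_iUnion₂.2 ⟨k, hk, q, hq, ?_⟩⟩
  have e1 : 𝒢.s (𝒢.inv (t k (𝒢.r q))) = 𝒢.r q := by rw [𝒢.s_inv, H.r_t]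
  have e2 : 𝒢.s (𝒢.mul (𝒢.inv (t k (𝒢.r q))) q) = 𝒢.s q := 𝒢.s_mul _ _ e1
  have e3 : 𝒢.s q = 𝒢.r (𝒢.inv (τ a x)) := by rw [𝒢.r_inv, hqs]
  have e4 : 𝒢.s g = 𝒢.r (τ a (𝒢.s g)) := (hr _ _).symm
  have e5 : 𝒢.s (𝒢.inv (τ a x)) = x := by rw [𝒢.s_inv, hr]
  have e6 : 𝒢.s (𝒢.mul (𝒢.mul (𝒢.inv (t k (𝒢.r q))) q) (𝒢.inv (τ a x))) = x := by
    rw [𝒢.s_mul _ _ (by rw [e2, e3]), e5]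
  refine (H.centralCoset_eq (by rwa [e6]) ⟨c, ?_⟩).symm
  simp only
  rw [e6]
  have h1 : 𝒢.mul (τ (α g * a) (𝒢.r g)) (𝒢.transport τ α a g) = 𝒢.mul g (τ a (𝒢.s g)) :=
    𝒢.mul_inv_cancel_left (by rw [hr, 𝒢.r_mul _ _ e4])
  have h2 := 𝒢.mul_inv_cancel_right e4
  have h3 := H.mul_mul_ι (e2.trans e3) (by rwa [e5]) c
  rw [← h1, ← hc, hbk, hgx] at h2
  rw [e5, e2, 𝒢.mul_assoc _ _ _ e1 (H.r_ι _ hqX c).symm, h2] at h3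
  exact h3.symm

/-- For fixed `k`, only the first `k + 1` arrows out of each unit and the finite set `F k` are
tested, so the failure set for `ψ n` has measure tending to zero with `n`. A diagonal choice `m k`
then works for every arrow from some `k` on. -/
theorem IsGHAPFamilyOn.exists_subsequence [Countable C] [TopologicalSpace C] [DiscreteTopology C]
    [MeasurableSpace A] [DiscreteMeasurableSpace A]
    {V : ℕ → Set (PontryaginDual C)} {ψ : ℕ → PontryaginDual C → G → ℂ}
    (hψ : 𝒢.IsGHAPFamilyOn μ 𝒮 ι V ψ) (H : 𝒢.IsRegularOn 𝒮 ι α t X₀)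
    (h𝒢 : 𝒢.IsQuasiInvariant μ) (hX₀ : ∀ᵐ x ∂μ, x ∈ X₀) (ht : ∀ k, Measurable (t k))
    (hα : Measurable α) (hτ : ∀ b, Measurable (τ b)) (hr : ∀ b x, 𝒢.r (τ b x) = x)
    (hατ : ∀ g, 𝒢.s g ∈ X₀ → ∀ a, α (τ (α g * a) (𝒢.r g)) = α g * α (τ a (𝒢.s g)))
    (F : ℕ → Finset A) :
    ∃ m : ℕ → ℕ, ∀ᵐ x ∂μ, ∀ g, 𝒢.s g = x → ∀ᶠ k : ℕ in atTop, ∀ χ ∈ V (m k), ∀ a ∈ F k,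
      ‖ψ (m k) χ (𝒢.transport τ α a g) - 1‖ ≤ 1 / ((k : ℝ) + 1) := by
  have := PontryaginDual.secondCountableTopology C
  -- The failure sets must be measurable, so only countably many characters are tested; continuity
  -- in `χ` later extends the bound to all of `V (m k)`.
  choose D hDV hDc hDcl using fun n => exists_countable_subset_closure_eq (hψ.isCompact n)
  let E : ℕ → ℕ → Set G := fun k n => ⋃ χ ∈ D n, ⋃ a ∈ F k,
    {g | 1 / ((k : ℝ) + 1) < ‖ψ n χ (𝒢.transport τ α a g) - 1‖}
  have hEm : ∀ k n, NullMeasurableSet (E k n) (𝒢.arrowMeasure μ) := by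
    intro k n
    refine NullMeasurableSet.biUnion (hDc n) fun χ hχ => ?_
    refine NullMeasurableSet.biUnion (F k).countable_toSet fun a _ => ?_
    exact nullMeasurableSet_lt aemeasurable_const
      (((hψ.aemeasurable n χ (hDV n hχ)).comp_quasiMeasurePreserving
        (h𝒢.quasiMeasurePreserving_transport hτ hα hr a)).sub_const 1).norm
  -- The `t j x` enumerate the arrows into `x`, hence their inverses enumerate the arrows out of
  -- `x`.
  let B : ℕ → ℕ → Set X := fun k n =>
    ⋃ j ∈ Finset.range (k + 1), (fun x => 𝒢.inv (t j x)) ⁻¹' E k n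
  have hBm : ∀ k n, NullMeasurableSet (B k n) μ := fun k n =>
    NullMeasurableSet.biUnion (Finset.countable_toSet _) fun j _ =>
      (hEm k n).preimage (quasiMeasurePreserving_inv_comp (ht j) (H.r_t j))
  obtain ⟨X₁, hX₁, hlim, H₁⟩ := H.exists_mono h𝒢 hX₀ (hψ.tendsto.and hX₀)
  have hBev : ∀ k, ∀ᵐ x ∂μ, ∀ᶠ n in atTop, x ∉ B k n := by
    intro k
    filter_upwards [hX₁] with x hx
    have h1 : ∀ j ∈ Finset.range (k + 1), ∀ᶠ n in atTop, ∀ a ∈ F k, ∀ χ ∈ V n,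
        ‖ψ n χ (𝒢.transport τ α a (𝒢.inv (t j x))) - 1‖ < 1 / ((k : ℝ) + 1) := by
      intro j _
      rw [eventually_all_finset]
      intro a _
      have hs : 𝒢.s (𝒢.inv (t j x)) = x := by rw [𝒢.s_inv, H.r_t]
      obtain ⟨N, hN⟩ := (hlim _ (H₁.s_τ_mem hr hx a)).1 _
        (H.transport_mem hr hατ (hs ▸ (hlim x hx).2) a) (by rw [IsRegularOn.s_transport hr, hs])
        (1 / ((k : ℝ) + 1)) (by positivity)
      exact eventually_atTop.2 ⟨N, hN⟩
    filter_upwards [(eventually_all_finset _).2 h1] with n hn hmem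
    obtain ⟨j, hj, hmem⟩ := Set.mem_iUnion₂.1 hmem
    obtain ⟨χ, hχ, hmem⟩ := Set.mem_iUnion₂.1 hmem
    obtain ⟨a, ha, hmem⟩ := Set.mem_iUnion₂.1 hmem
    exact lt_asymm (hn j hj a ha χ (hDV n hχ)) hmem
  obtain ⟨m, hm⟩ := exists_diagonal_ae_eventually_notMem hBm hBev
  refine ⟨m, ?_⟩
  obtain ⟨X₂, hX₂, hcont, H₂⟩ := H.exists_mono h𝒢 hX₀ ((ae_all_iff.2 hψ.continuousOn).and hX₀)
  filter_upwards [hm, hX₂] with x hx hx₂ g hg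
  have hgX : 𝒢.s g ∈ X₂ := hg ▸ hx₂
  have hgX₀ : 𝒢.s g ∈ X₀ := (hcont _ hgX).2
  obtain ⟨j, hj⟩ := H.exists_eq_t (𝒢.inv g) (by rwa [𝒢.s_inv, ← H.invariant])
  have hjg : 𝒢.inv (t j x) = g := by rw [← hg, ← 𝒢.r_inv, ← hj, 𝒢.inv_inv]
  filter_upwards [hx, eventually_ge_atTop j] with k hk hjk χ hχ a ha
  have hD : ∀ χ ∈ D (m k), ‖ψ (m k) χ (𝒢.transport τ α a g) - 1‖ ≤ 1 / ((k : ℝ) + 1) := by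
    intro χ hχ
    by_contra! hlt
    refine hk (Set.mem_iUnion₂.2 ⟨j, Finset.mem_range.2 (by omega), ?_⟩)
    rw [Set.mem_preimage, hjg]
    exact Set.mem_iUnion₂.2 ⟨χ, hχ, Set.mem_iUnion₂.2 ⟨a, ha, hlt⟩⟩
  have hc := (hcont _ (H₂.s_τ_mem hr hgX a)).1 (m k) _ (H.transport_mem hr hατ hgX₀ a)
    (IsRegularOn.s_transport hr a g)
  refine le_on_closure hD ?_ continuousOn_const (by rwa [hDcl])
  rw [hDcl]
  exact (hc.sub continuousOn_const).norm

end DiscreteBorelGroupoid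

end

/-! ### The averaged family has the generalized Haagerup property -/

theorem proposition4p15 {X G C A : Type*}
    [MeasurableSpace X] [StandardBorelSpace X] [MeasurableSpace G] [StandardBorelSpace G]
    (μ : Measure X) [IsProbabilityMeasure μ]
    (𝒢 : DiscreteBorelGroupoid X G) (h𝒢 : 𝒢.IsQuasiInvariant μ)
    (𝒮 : 𝒢.Subgroupoid) (h𝒮 : NullMeasurableSet 𝒮.carrier (𝒢.arrowMeasure μ))
    [Group C] [Countable C] [TopologicalSpace C] [DiscreteTopology C]
    [MeasurableSpace C] [DiscreteMeasurableSpace C]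
    (ι : C × X → G) (hι : 𝒢.IsCentralSubgroupoid μ ι)
    (hι𝒮 : ∀ᵐ p ∂((DiscreteBorelGroupoid.trivialAction C X).arrowMeasure μ), ι p ∈ 𝒮.carrier)
    [Group A] [Countable A] [MeasurableSpace A] [DiscreteMeasurableSpace A]
    (hA : IsAmenableGroup A)
    (α : G → A)
    (hα : 𝒢.IsHom μ (DiscreteBorelGroupoid.ofGroup A) (Measure.dirac ()) α)
    (hker : α ⁻¹' {1} =ᵐ[𝒢.arrowMeasure μ] 𝒮.carrier)
    (hAα : (∀ a b : A, a * b = b * a) ∨ ∀ᵐ x ∂μ, α '' {g | 𝒢.s g = x} = Set.univ)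
    (hgHAP : 𝒮.toGroupoid.HasGHAP μ (𝒮.codRestrict ι)) :
    𝒢.HasGHAP μ ι := by
  obtain ⟨β, t, X₀, hβ, ht, hX₀, H⟩ :=
    DiscreteBorelGroupoid.exists_isRegularOn h𝒢 hι hι𝒮 hα hker
  obtain ⟨V, ψ, hψ⟩ := 𝒮.exists_isGHAPFamilyOn h𝒮 hX₀ H hgHAP
  obtain ⟨enc, henc⟩ := Countable.exists_injective_nat A
  let τ : A → X → G := DiscreteBorelGroupoid.minimalSection enc β t
  have hτ : ∀ b, Measurable (τ b) := DiscreteBorelGroupoid.measurable_minimalSection hβ ht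
  have hr : ∀ b x, 𝒢.r (τ b x) = x := DiscreteBorelGroupoid.r_minimalSection H.r_t
  have hατ : ∀ g, 𝒢.s g ∈ X₀ → ∀ a, β (τ (β g * a) (𝒢.r g)) = β g * β (τ a (𝒢.s g)) :=
    fun g hg a => H.α_minimalSection henc hg a
  obtain ⟨F, hF, hFol⟩ := hA
  obtain ⟨m, hm⟩ := hψ.exists_subsequence H h𝒢 hX₀ ht hβ hτ hr hατ F
  refine ⟨fun k => V (m k), fun k χ => 𝒢.folnerAverage τ β (F k) (ψ (m k) χ),
    fun k => ⟨hψ.isCompact _, hψ.mem_nhds _⟩, fun k χ hχ => ?_, ?_, fun k χ hχ => ?_,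
    fun k => ?_, fun k χ hχ => ?_⟩
  · refine ⟨⟨h𝒢.aemeasurable_folnerAverage hτ hβ hr _ (hψ.aemeasurable _ χ hχ), ?_⟩, ?_⟩
    -- The average at `x` uses `ψ` over other units of the orbit, so the condition on `ψ` is first
    -- made to hold on an invariant conull set.
    · obtain ⟨X₁, hX₁, hP, H₁⟩ := H.exists_mono h𝒢 hX₀ ((hψ.nonneg _ χ hχ).and hX₀)
      filter_upwards [hX₁] with x hx n g lam hg
      exact H₁.folnerAverage_nonneg hr (fun g hg => hατ g (hP _ hg).2)
        (fun x hx => (hP x hx).1) hx n g lam hg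
    · obtain ⟨X₁, hX₁, hP, H₁⟩ := H.exists_mono h𝒢 hX₀ (hψ.map_unit _ χ hχ)
      filter_upwards [hX₁] with x hx
      exact H₁.folnerAverage_unit hr (hF k) hP hx
  · rw [DiscreteBorelGroupoid.ae_arrowMeasure_iff]
    filter_upwards [hm] with x hx g hg ε hε
    -- One half of `ε` pays for the error of `ψ`, the other for the Følner defect at `β g`.
    have h1 : ∀ᶠ k : ℕ in atTop, 1 / ((k : ℝ) + 1) < ε / 2 :=
      tendsto_one_div_add_atTop_nhds_zero_nat.eventually_lt_const (half_pos hε)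
    have h2 := (hFol (β g)).eventually_lt_const (half_pos hε)
    refine eventually_atTop.1 ?_
    filter_upwards [hx g hg, h1, h2] with k h3 h1 h2 χ hχ
    refine (DiscreteBorelGroupoid.norm_folnerAverage_sub_one_le (hF k)
      (by positivity) (h3 χ hχ)).trans_lt ?_
    linarith
  · rw [DiscreteBorelGroupoid.ae_arrowMeasure_iff]
    obtain ⟨X₁, hX₁, hP, H₁⟩ := H.exists_mono h𝒢 hX₀ ((hψ.map_mul_ι _ χ hχ).and hX₀)
    filter_upwards [hX₁] with x hx g hg c
    exact H₁.folnerAverage_mul_ι hr (fun g hg => hατ g (hP _ hg).2)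
      (fun g hgS hgX => (hP _ hgX).1 g hgS rfl c) (hg ▸ hx)
  · rw [DiscreteBorelGroupoid.ae_arrowMeasure_iff]
    obtain ⟨X₁, hX₁, hP, H₁⟩ := H.exists_mono h𝒢 hX₀ ((hψ.continuousOn (m k)).and hX₀)
    filter_upwards [hX₁] with x hx g hg
    subst hg
    refine DiscreteBorelGroupoid.continuousOn_folnerAverage fun a _ => ?_
    exact (hP _ (H₁.s_τ_mem hr hx a)).1 _ (H.transport_mem hr hατ (hP _ hx).2 a)
      (DiscreteBorelGroupoid.IsRegularOn.s_transport hr a g)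
  · exact H.isC0ModCentral_folnerAverage h𝒢 hX₀ ht hτ hr hατ (hF k) (hψ.c0 _ χ hχ)
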